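/- For $N\in\mathbb N$ and $\Omega>0$ write $\omega_N=N^{1/3}(\Omega\log N)^{2/3}$ and, for $1\le k\le N$, $\hat k=N-k$. For every $R>0$ and $C>0$ there is a constant $c_R>0$, depending only on $R$ and $C$, such that for every sequence $\Omega=\Omega(N)>0$ with $\Omega=o\big(N^{1/10}/\log N\big)$ there is an $N_0$ (depending on $R$, $C$ and the sequence $\Omega$) for which the following holds for all $N\ge N_0$. Let $\rho_1,\dots,\rho_N\in\mathbb C$ be deterministic with $$|\rho_k|\le \exp\Big(-c_0\sqrt{\tfrac{\omega_N+\hat k}{N}}\Big),\qquad 1\le k\le N,$$ for some $c_0>1$, and let $\eta_{k,12},\eta_{k,21},\eta_{k,22}$, $1\le k\le N$, be complex random variables on a common probability space such that the random matrices $$U_k=\begin{pmatrix}1&\eta_{k,12}\\ \eta_{k,21}&\rho_k-\eta_{k,22}\end{pmatrix},\qquad 1\le k\le N,$$ are independent and, for all $1\le k\le N$ and $ij\in\{12,21,22\}$, $$|\mathbb E\,\eta_{k,ij}|\le\frac{C}{\omega_N+\hat k},\qquad \operatorname{Var}(\eta_{k,ij})=\mathbb E|\eta_{k,ij}-\mathbb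 E\eta_{k,ij}|^2\le\frac{C}{\omega_N+\hat k},\qquad |\eta_{k,ij}|\le\sqrt{\frac{R\,\Omega\log N}{\omega_N+\hat k}}\ \text{ almost surely.}$$ Then for every $\varepsilon\ge N^{-R}$, $$\mathbb P\left[\left\|U_NU_{N-1}\cdots U_1-\begin{pmatrix}1&0\\0&0\end{pmatrix}\right\|\ge\varepsilon\right]\le c_R^{-1}\left(N^{-c_R\varepsilon^2\Omega}+N^{4-R\Omega}\right),$$ where $\|\cdot\|$ is the operator norm on $\mathbb C^2$ with its Euclidean norm. -/

import Mathlib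

open Filter Asymptotics MeasureTheory ProbabilityTheory

noncomputable section

/-- Operator norm of a complex `2 × 2` matrix with respect to the Euclidean norm on `ℂ²`. -/
def opNorm (M : Matrix (Fin 2) (Fin 2) ℂ) : ℝ :=
  ‖Matrix.toEuclideanCLM (n := Fin 2) (𝕜 := ℂ) M‖

/-- The product `σ`-algebra on complex `2 × 2` matrices (all entries are measurable). -/
instance matrixMeasurableSpace : MeasurableSpace (Matrix (Fin 2) (Fin 2) ℂ) :=
  inferInstanceAs (MeasurableSpace (Fin 2 → Fin 2 → ℂ))

/-- The ordered product `U_n U_{n-1} ⋯ U_1`, later factors standing on the left. -/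
def orderedProd (U : ℕ → Matrix (Fin 2) (Fin 2) ℂ) : ℕ → Matrix (Fin 2) (Fin 2) ℂ
  | 0 => 1
  | n + 1 => U (n + 1) * orderedProd U n

/-- The matrix `[[1, η₁₂], [η₂₁, ρ - η₂₂]]`. Rows and columns are numbered from `0` here, so
`η₁₂ = η 0 1`, `η₂₁ = η 1 0` and `η₂₂ = η 1 1`; the entry `η 0 0` is not used. -/
def hypMatrix (ρ : ℂ) (η : Fin 2 → Fin 2 → ℂ) : Matrix (Fin 2) (Fin 2) ℂ :=
  !![1, η 0 1; η 1 0, ρ - η 1 1]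

/-- Variance `𝔼 |X - 𝔼 X|²` of a complex random variable. -/
def complexVar {S : Type*} [MeasurableSpace S] (P : Measure S) (X : S → ℂ) : ℝ :=
  ∫ s, ‖X s - ∫ t, X t ∂P‖ ^ 2 ∂P

/-- `ω_N = N^{1/3} (Ω log N)^{2/3}`. -/
def omegaN (N : ℕ) (Ω : ℝ) : ℝ :=
  (N : ℝ) ^ (1 / 3 : ℝ) * (Ω * Real.log N) ^ (2 / 3 : ℝ)

/-- `ω_N + k̂` with `k̂ = N - k`. -/
def omegaHat (N : ℕ) (Ω : ℝ) (k : ℕ) : ℝ :=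
  omegaN N Ω + ((N : ℝ) - (k : ℝ))

end

/-! Fix a column of `U_n ⋯ U_1`, let `e` be its initial first entry (1 or 0), and write it as `(e +
u, b)`. A step sends `u` to `u + η₁₂ b` and `b` to `η₂₁ (e + u) + (ρ - η₂₂) b`: the second entry
contracts at rate `δ = √(w/N)`, with `w = ω + N - k`, while noise of mean and variance `O(1/w)`
feeds each entry into the other. The goal is that `u` and `b` are small at time `N`.

The proof follows the moment of order `p = κ L`, `L = Ω log N`, of the potential `Φ_n = ‖u‖² + λ_n
‖b‖² + κ`. Since `Φ` never falls below `κ`, the forcing by `e` is small relative to it. Contraction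
supplies a loss of order `δ λ ‖b‖²`, which absorbs the mixed drift (Young) and the second-order
noise; `lintegral_potential_step_le` turns this into a factor `exp (p g)`, `g = 100 (B²/(δλ) +
λB/κ)`, `B = C/w`.

The weight is `λ_n = Aκω/(ω+N-n) + E_n/(2A)`, with `E_n = exp (-(d/2)(N-n))` and `d = √(ω/N)`. The
first term keeps `λ` large enough to dominate the noise. The second lets `λ` rise from `O(κ)`
initially, where `b` may be 1, to order one at time `N`, more slowly than the contraction. Because
`ω d = L` and `κ L ≥ 1`, the growth `g` has a sum bounded in terms of `A` and `C` (`growth_le`).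

Thus the final moment is at most `(const · κ)^p`. Markov's inequality bounds the tail by `2 (K κ /
ε²)^(κ L)`, and `κ` is chosen proportional to `ε²`, or equal to its largest admissible value when
`ε` is large. -/

/-! ### Moments of the one-step noise -/

section OneStep

variable {S : Type*} [MeasurableSpace S] {P : Measure S} [IsProbabilityMeasure P]

/-- Since `exp y ≤ 1 + y + y²` on `[-1, 1]`, two moments suffice to control an exponential one. -/
theorem lintegral_exp_le_of_abs_le_one {Y : S → ℝ} (hm : Measurable Y)
    (hY : ∀ᵐ s ∂P, |Y s| ≤ 1) :
    ∫⁻ s, ENNReal.ofReal (Real.exp (Y s)) ∂P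
      ≤ ENNReal.ofReal (Real.exp (∫ s, Y s ∂P + ∫ s, Y s ^ 2 ∂P)) := by
  have i1 : Integrable Y P := Integrable.of_bound hm.aestronglyMeasurable 1 hY
  have i2 : Integrable (fun s => Y s ^ 2) P := by
    refine Integrable.of_bound (hm.pow_const 2).aestronglyMeasurable 1 ?_
    filter_upwards [hY] with s hs
    rw [Real.norm_eq_abs, abs_of_nonneg (sq_nonneg _)]
    exact (sq_le_one_iff_abs_le_one _).2 hs
  have i3 : Integrable (fun s => 1 + Y s + Y s ^ 2) P := ((integrable_const 1).add i1).add i2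
  calc ∫⁻ s, ENNReal.ofReal (Real.exp (Y s)) ∂P
      ≤ ∫⁻ s, ENNReal.ofReal (1 + Y s + Y s ^ 2) ∂P := by
        refine lintegral_mono_ae ?_
        filter_upwards [hY] with s hs
        refine ENNReal.ofReal_le_ofReal ?_
        have := (abs_le.1 (Real.abs_exp_sub_one_sub_id_le hs)).2
        linarith
    _ = ENNReal.ofReal (∫ s, (1 + Y s + Y s ^ 2) ∂P) := by
        refine (ofReal_integral_eq_lintegral_ofReal i3 ?_).symm
        refine Eventually.of_forall fun s => ?_
        show 0 ≤ 1 + Y s + Y s ^ 2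
        nlinarith [sq_nonneg (Y s + 1), sq_nonneg (Y s)]
    _ ≤ _ := by
        refine ENNReal.ofReal_le_ofReal ?_
        rw [integral_add (by exact (integrable_const 1).add i1) i2,
          integral_add (integrable_const 1) i1]
        simp only [integral_const, probReal_univ, smul_eq_mul, mul_one]
        linarith [Real.add_one_le_exp (∫ s, Y s ∂P + ∫ s, Y s ^ 2 ∂P)]

theorem integral_norm_add_sq_sub_le {X : S → ℂ} (hm : Measurable X) {H : ℝ}
    (hX : ∀ᵐ s ∂P, ‖X s‖ ≤ H) (v : ℂ) :
    ∫ s, (‖v + X s‖ ^ 2 - ‖v‖ ^ 2) ∂P ≤ 2 * ‖v‖ * ‖∫ s, X s ∂P‖ + ∫ s, ‖X s‖ ^ 2 ∂P := by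
  have i1 : Integrable X P := Integrable.of_bound hm.aestronglyMeasurable H hX
  have i2 : Integrable (fun s => ‖X s‖ ^ 2) P := by
    refine Integrable.of_bound (hm.norm.pow_const 2).aestronglyMeasurable (H ^ 2) ?_
    filter_upwards [hX] with s hs
    rw [Real.norm_eq_abs, abs_of_nonneg (sq_nonneg _)]
    gcongr
  have e : (fun s => ‖v + X s‖ ^ 2 - ‖v‖ ^ 2)
      = fun s => 2 * inner ℝ v (X s) + ‖X s‖ ^ 2 := by
    funext s
    rw [norm_add_sq_real]; ring
  rw [e, integral_add ((i1.const_inner v).const_mul 2) i2, integral_const_mul, integral_inner i1]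
  have := real_inner_le_norm v (∫ s, X s ∂P)
  nlinarith

theorem abs_norm_add_sq_sub_le (v x : ℂ) :
    |‖v + x‖ ^ 2 - ‖v‖ ^ 2| ≤ 2 * ‖v‖ * ‖x‖ + ‖x‖ ^ 2 := by
  rw [norm_add_sq_real, abs_le]
  have h := abs_le.1 (abs_real_inner_le_norm v x)
  constructor <;> nlinarith [sq_nonneg ‖x‖, h.1, h.2]

/-- Concavity of the logarithm. It converts a `p`-th power of the new potential into an exponential
that is linear in the increment. -/
theorem rpow_le_rpow_mul_exp {x y p : ℝ} (hx : 0 < x) (hy : 0 ≤ y) (hp : 0 ≤ p) :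
    y ^ p ≤ x ^ p * Real.exp (p * (y - x) / x) := by
  have h1 : y ≤ x * Real.exp ((y - x) / x) := by
    have := Real.add_one_le_exp ((y - x) / x)
    calc y = x * ((y - x) / x + 1) := by field_simp; ring
      _ ≤ _ := by gcongr
  calc y ^ p ≤ (x * Real.exp ((y - x) / x)) ^ p := Real.rpow_le_rpow hy h1 hp
    _ = x ^ p * Real.exp (p * (y - x) / x) := by
      rw [Real.mul_rpow hx.le (Real.exp_pos _).le, ← Real.exp_mul]
      congr 2; ring

/-- The fluctuation of the quadratic potential `‖u‖² + l ‖b‖²` in one step. -/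
noncomputable def fluctuation (l : ℝ) (u a v b : ℂ) (x y z : ℂ) : ℝ :=
  (‖u + x * b‖ ^ 2 - ‖u‖ ^ 2) + l * (‖v + (y * a - z * b)‖ ^ 2 - ‖v‖ ^ 2)

/-- One factor of each squared noise is spent on the sup bound (`H`, or just 1 for `z`). The result
is linear in the noise, so its square needs second moments only. -/
theorem abs_fluctuation_le {l H : ℝ} (hl : 0 ≤ l) (H1 : H ≤ 1) {u a v b x y z : ℂ}
    (hv : ‖v‖ ≤ ‖b‖) (hx : ‖x‖ ≤ H) (hy : ‖y‖ ≤ H) (hz : ‖z‖ ≤ H) :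
    |fluctuation l u a v b x y z| ≤ (2 * ‖u‖ * ‖b‖ + H * ‖b‖ ^ 2) * ‖x‖
      + l * (2 * ‖b‖ * ‖a‖ + 2 * H * ‖a‖ ^ 2) * ‖y‖ + l * (4 * ‖b‖ ^ 2) * ‖z‖ := by
  have h1 := abs_norm_add_sq_sub_le u (x * b)
  have h2 := abs_norm_add_sq_sub_le v (y * a - z * b)
  have h3 : ‖y * a - z * b‖ ≤ ‖y‖ * ‖a‖ + ‖z‖ * ‖b‖ := by
    simpa using norm_sub_le (y * a) (z * b)
  rw [norm_mul] at h1
  have h4 : 2 * ‖u‖ * (‖x‖ * ‖b‖) + (‖x‖ * ‖b‖) ^ 2 ≤ (2 * ‖u‖ * ‖b‖ + H * ‖b‖ ^ 2) * ‖x‖ := by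
    have : (‖x‖ * ‖b‖) ^ 2 ≤ H * ‖b‖ ^ 2 * ‖x‖ := by
      calc (‖x‖ * ‖b‖) ^ 2 = ‖x‖ * (‖b‖ ^ 2 * ‖x‖) := by ring
        _ ≤ H * (‖b‖ ^ 2 * ‖x‖) := by gcongr
        _ = _ := by ring
    linarith
  have h5 : 2 * ‖v‖ * ‖y * a - z * b‖ + ‖y * a - z * b‖ ^ 2
      ≤ (2 * ‖b‖ * ‖a‖ + 2 * H * ‖a‖ ^ 2) * ‖y‖ + (4 * ‖b‖ ^ 2) * ‖z‖ := by
    have e1 : ‖y‖ ^ 2 * ‖a‖ ^ 2 ≤ H * ‖a‖ ^ 2 * ‖y‖ := by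
      calc ‖y‖ ^ 2 * ‖a‖ ^ 2 = ‖y‖ * (‖a‖ ^ 2 * ‖y‖) := by ring
        _ ≤ H * (‖a‖ ^ 2 * ‖y‖) := by gcongr
        _ = _ := by ring
    have e2 : ‖z‖ ^ 2 * ‖b‖ ^ 2 ≤ ‖b‖ ^ 2 * ‖z‖ := by
      calc ‖z‖ ^ 2 * ‖b‖ ^ 2 = ‖z‖ * (‖b‖ ^ 2 * ‖z‖) := by ring
        _ ≤ 1 * (‖b‖ ^ 2 * ‖z‖) := by gcongr; exact hz.trans H1
        _ = _ := by ring
    have e3 : 2 * ‖v‖ * ‖y * a - z * b‖ ≤ 2 * ‖b‖ * (‖y‖ * ‖a‖ + ‖z‖ * ‖b‖) := by gcongr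
    have e4 : ‖y * a - z * b‖ ^ 2 ≤ (‖y‖ * ‖a‖ + ‖z‖ * ‖b‖) ^ 2 := by gcongr
    nlinarith [sq_nonneg (‖y‖ * ‖a‖ - ‖z‖ * ‖b‖)]
  have h6 : |l * (‖v + (y * a - z * b)‖ ^ 2 - ‖v‖ ^ 2)|
      ≤ l * ((2 * ‖b‖ * ‖a‖ + 2 * H * ‖a‖ ^ 2) * ‖y‖ + (4 * ‖b‖ ^ 2) * ‖z‖) := by
    rw [abs_mul, abs_of_nonneg hl]
    exact mul_le_mul_of_nonneg_left (h2.trans h5) hl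
  unfold fluctuation
  refine (abs_add_le _ _).trans ?_
  linarith

section moments

variable {x y z : S → ℂ} {B H : ℝ}

theorem measurable_fluctuation (hx : Measurable x) (hy : Measurable y) (hz : Measurable z)
    (l : ℝ) (u a v b : ℂ) :
    Measurable fun s => fluctuation l u a v b (x s) (y s) (z s) := by
  unfold fluctuation
  fun_prop

theorem integral_fluctuation_le {l : ℝ} (hl : 0 ≤ l)
    (hx : Measurable x) (hy : Measurable y) (hz : Measurable z)
    (bx : ∀ᵐ s ∂P, ‖x s‖ ≤ H) (hb : ∀ᵐ s ∂P, ‖y s‖ ≤ H) (bz : ∀ᵐ s ∂P, ‖z s‖ ≤ H)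
    (ex : ‖∫ s, x s ∂P‖ ≤ B) (ey : ‖∫ s, y s ∂P‖ ≤ B) (ez : ‖∫ s, z s ∂P‖ ≤ B)
    (vx : ∫ s, ‖x s‖ ^ 2 ∂P ≤ 2 * B) (vy : ∫ s, ‖y s‖ ^ 2 ∂P ≤ 2 * B)
    (vz : ∫ s, ‖z s‖ ^ 2 ∂P ≤ 2 * B) {u a v b : ℂ} (hv : ‖v‖ ≤ ‖b‖) :
    ∫ s, fluctuation l u a v b (x s) (y s) (z s) ∂P
      ≤ 2 * ‖u‖ * ‖b‖ * B + 2 * B * ‖b‖ ^ 2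
        + l * (2 * ‖b‖ * (‖a‖ + ‖b‖) * B + 4 * B * (‖a‖ ^ 2 + ‖b‖ ^ 2)) := by
  have int1 : ∀ {f : S → ℂ}, Measurable f → (∀ᵐ s ∂P, ‖f s‖ ≤ H) → Integrable f P :=
    fun hm hb => Integrable.of_bound hm.aestronglyMeasurable H hb
  have int2 : ∀ {f : S → ℂ}, Measurable f → (∀ᵐ s ∂P, ‖f s‖ ≤ H) →
      Integrable (fun s => ‖f s‖ ^ 2) P := fun {f} hm hb => by
    refine Integrable.of_bound (hm.norm.pow_const 2).aestronglyMeasurable (H ^ 2) ?_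
    filter_upwards [hb] with s hs
    rw [Real.norm_eq_abs, abs_of_nonneg (sq_nonneg _)]
    gcongr
  have intd : ∀ {f : S → ℂ} {K : ℝ} (v : ℂ), Measurable f → (∀ᵐ s ∂P, ‖f s‖ ≤ K) →
      Integrable (fun s => ‖v + f s‖ ^ 2 - ‖v‖ ^ 2) P := fun {f K} v hm hb => by
    refine Integrable.of_bound (by fun_prop) (2 * ‖v‖ * K + K ^ 2) ?_
    filter_upwards [hb] with s hs
    refine (abs_norm_add_sq_sub_le v (f s)).trans ?_
    gcongr
  have mX : Measurable fun s => x s * b := by fun_prop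
  have mY : Measurable fun s => y s * a - z s * b := by fun_prop
  have bX : ∀ᵐ s ∂P, ‖x s * b‖ ≤ H * ‖b‖ := by
    filter_upwards [bx] with s hs
    rw [norm_mul]; gcongr
  have bY : ∀ᵐ s ∂P, ‖y s * a - z s * b‖ ≤ H * ‖a‖ + H * ‖b‖ := by
    filter_upwards [hb, bz] with s h1 h2
    refine (norm_sub_le _ _).trans ?_
    rw [norm_mul, norm_mul]; gcongr
  have e1 := integral_norm_add_sq_sub_le mX bX u
  have e2 := integral_norm_add_sq_sub_le mY bY v
  have f1 : ‖∫ s, x s * b ∂P‖ ≤ B * ‖b‖ := by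
    rw [integral_mul_const, norm_mul]; gcongr
  have f2 : ∫ s, ‖x s * b‖ ^ 2 ∂P ≤ 2 * B * ‖b‖ ^ 2 := by
    simp_rw [norm_mul, mul_pow]
    rw [integral_mul_const]; gcongr
  have f3 : ‖∫ s, (y s * a - z s * b) ∂P‖ ≤ B * (‖a‖ + ‖b‖) := by
    rw [integral_sub ((int1 hy hb).mul_const a) ((int1 hz bz).mul_const b),
      integral_mul_const, integral_mul_const]
    refine (norm_sub_le _ _).trans ?_
    rw [norm_mul, norm_mul, mul_add]; gcongr
  have f4 : ∫ s, ‖y s * a - z s * b‖ ^ 2 ∂P ≤ 4 * B * (‖a‖ ^ 2 + ‖b‖ ^ 2) := by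
    have i : Integrable (fun s => 2 * ‖a‖ ^ 2 * ‖y s‖ ^ 2 + 2 * ‖b‖ ^ 2 * ‖z s‖ ^ 2) P :=
      ((int2 hy hb).const_mul _).add ((int2 hz bz).const_mul _)
    calc ∫ s, ‖y s * a - z s * b‖ ^ 2 ∂P
        ≤ ∫ s, (2 * ‖a‖ ^ 2 * ‖y s‖ ^ 2 + 2 * ‖b‖ ^ 2 * ‖z s‖ ^ 2) ∂P := by
          refine integral_mono_of_nonneg (Eventually.of_forall fun s => sq_nonneg _) i
            (Eventually.of_forall fun s => ?_)
          have : ‖y s * a - z s * b‖ ≤ ‖y s‖ * ‖a‖ + ‖z s‖ * ‖b‖ := by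
            simpa using norm_sub_le (y s * a) (z s * b)
          have : ‖y s * a - z s * b‖ ^ 2 ≤ (‖y s‖ * ‖a‖ + ‖z s‖ * ‖b‖) ^ 2 := by gcongr
          show ‖y s * a - z s * b‖ ^ 2 ≤ 2 * ‖a‖ ^ 2 * ‖y s‖ ^ 2 + 2 * ‖b‖ ^ 2 * ‖z s‖ ^ 2
          nlinarith [sq_nonneg (‖y s‖ * ‖a‖ - ‖z s‖ * ‖b‖)]
      _ = 2 * ‖a‖ ^ 2 * ∫ s, ‖y s‖ ^ 2 ∂P + 2 * ‖b‖ ^ 2 * ∫ s, ‖z s‖ ^ 2 ∂P := by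
          rw [integral_add ((int2 hy hb).const_mul _) ((int2 hz bz).const_mul _),
            integral_const_mul, integral_const_mul]
      _ ≤ 2 * ‖a‖ ^ 2 * (2 * B) + 2 * ‖b‖ ^ 2 * (2 * B) := by gcongr
      _ = _ := by ring
  have B0 : 0 ≤ B := (norm_nonneg _).trans ex
  unfold fluctuation
  rw [integral_add (intd u mX bX) ((intd v mY bY).const_mul l), integral_const_mul]
  have g1 : ∫ s, (‖u + x s * b‖ ^ 2 - ‖u‖ ^ 2) ∂P
      ≤ 2 * ‖u‖ * (B * ‖b‖) + 2 * B * ‖b‖ ^ 2 := by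
    refine e1.trans ?_
    gcongr
  have g2 : ∫ s, (‖v + (y s * a - z s * b)‖ ^ 2 - ‖v‖ ^ 2) ∂P
      ≤ 2 * ‖b‖ * (B * (‖a‖ + ‖b‖)) + 4 * B * (‖a‖ ^ 2 + ‖b‖ ^ 2) := by
    refine e2.trans ?_
    gcongr
  have g3 := mul_le_mul_of_nonneg_left g2 hl
  linarith

theorem integral_fluctuation_sq_le {l : ℝ} (hl : 0 ≤ l) (H1 : H ≤ 1)
    (hx : Measurable x) (hy : Measurable y) (hz : Measurable z)
    (bx : ∀ᵐ s ∂P, ‖x s‖ ≤ H) (hb : ∀ᵐ s ∂P, ‖y s‖ ≤ H) (bz : ∀ᵐ s ∂P, ‖z s‖ ≤ H)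
    (vx : ∫ s, ‖x s‖ ^ 2 ∂P ≤ 2 * B) (vy : ∫ s, ‖y s‖ ^ 2 ∂P ≤ 2 * B)
    (vz : ∫ s, ‖z s‖ ^ 2 ∂P ≤ 2 * B) {u a v b : ℂ} (hv : ‖v‖ ≤ ‖b‖) :
    ∫ s, fluctuation l u a v b (x s) (y s) (z s) ^ 2 ∂P
      ≤ 6 * B * ((2 * ‖u‖ * ‖b‖ + H * ‖b‖ ^ 2) ^ 2
        + (l * (2 * ‖b‖ * ‖a‖ + 2 * H * ‖a‖ ^ 2)) ^ 2 + (l * (4 * ‖b‖ ^ 2)) ^ 2) := by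
  have int2 : ∀ {f : S → ℂ}, Measurable f → (∀ᵐ s ∂P, ‖f s‖ ≤ H) →
      Integrable (fun s => ‖f s‖ ^ 2) P := fun {f} hm hb => by
    refine Integrable.of_bound (hm.norm.pow_const 2).aestronglyMeasurable (H ^ 2) ?_
    filter_upwards [hb] with s hs
    rw [Real.norm_eq_abs, abs_of_nonneg (sq_nonneg _)]
    gcongr
  set c1 := 2 * ‖u‖ * ‖b‖ + H * ‖b‖ ^ 2
  set c2 := l * (2 * ‖b‖ * ‖a‖ + 2 * H * ‖a‖ ^ 2)
  set c3 := l * (4 * ‖b‖ ^ 2)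
  have i1 := (int2 hx bx).const_mul (3 * c1 ^ 2)
  have i2 := (int2 hy hb).const_mul (3 * c2 ^ 2)
  have i3 := (int2 hz bz).const_mul (3 * c3 ^ 2)
  calc ∫ s, fluctuation l u a v b (x s) (y s) (z s) ^ 2 ∂P
      ≤ ∫ s, (3 * c1 ^ 2 * ‖x s‖ ^ 2 + 3 * c2 ^ 2 * ‖y s‖ ^ 2 + 3 * c3 ^ 2 * ‖z s‖ ^ 2) ∂P := by
        refine integral_mono_of_nonneg (Eventually.of_forall fun s => sq_nonneg _)
          ((i1.add i2).add i3) ?_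
        filter_upwards [bx, hb, bz] with s h1 h2 h3
        have h := abs_fluctuation_le (u := u) (a := a) hl H1 hv h1 h2 h3
        have h' : fluctuation l u a v b (x s) (y s) (z s) ^ 2
            ≤ (c1 * ‖x s‖ + c2 * ‖y s‖ + c3 * ‖z s‖) ^ 2 := by
          rw [← sq_abs]; gcongr
        refine h'.trans ?_
        nlinarith [sq_nonneg (c1 * ‖x s‖ - c2 * ‖y s‖), sq_nonneg (c1 * ‖x s‖ - c3 * ‖z s‖),
          sq_nonneg (c2 * ‖y s‖ - c3 * ‖z s‖)]
    _ = 3 * c1 ^ 2 * ∫ s, ‖x s‖ ^ 2 ∂P + 3 * c2 ^ 2 * ∫ s, ‖y s‖ ^ 2 ∂P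
        + 3 * c3 ^ 2 * ∫ s, ‖z s‖ ^ 2 ∂P := by
        rw [integral_add (by exact i1.add i2) i3, integral_add i1 i2, integral_const_mul,
          integral_const_mul, integral_const_mul]
    _ ≤ 3 * c1 ^ 2 * (2 * B) + 3 * c2 ^ 2 * (2 * B) + 3 * c3 ^ 2 * (2 * B) := by gcongr
    _ = _ := by ring

end moments
end OneStep

/-! ### Scalar inequalities: noise against dissipation -/

section Algebra

variable {U β α l m l' p H B δ : ℝ}

/-- In this section `U = ‖u‖`, `β = ‖b‖`, `α = ‖e + u‖`, `l = √λ`, `m = √κ`, whereas `l'` is the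
next weight itself and not its root. The additive `κ = m²` in the potential is what pays for `e`. -/
theorem sq_mul_sq_le_four_mul (hm1 : m ≤ 1) (hm : 0 < m) (hU : 0 ≤ U) (hα : 0 ≤ α)
    (hαU : α ≤ 1 + U) :
    m ^ 2 * α ^ 2 ≤ 4 * (U ^ 2 + l ^ 2 * β ^ 2 + m ^ 2) := by
  have h1 : α ^ 2 ≤ 2 + 2 * U ^ 2 := by nlinarith [sq_nonneg (1 - U)]
  have h2 : m ^ 2 ≤ 1 := by nlinarith
  have h3 : m ^ 2 * α ^ 2 ≤ m ^ 2 * (2 + 2 * U ^ 2) := by gcongr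
  nlinarith [mul_le_mul_of_nonneg_right h2 (sq_nonneg U), sq_nonneg (l * β), sq_nonneg m]

theorem fluctuation_bound_le (hU : 0 ≤ U) (hβ : 0 ≤ β) (hα : 0 ≤ α) (hαU : α ≤ 1 + U)
    (hl : 0 < l) (hl1 : l ≤ 1) (hm : 0 < m) (hm1 : m ≤ 1) (hl' : l' ≤ 3 * l ^ 2)
    (hp : 1 ≤ p) (hH : 0 ≤ H) (c1 : p * H ≤ l / 100) (c2 : p * H ≤ m / 100) :
    p * ((2 * U * β + H * β ^ 2) * H
      + l' * (2 * β * α + 2 * H * α ^ 2) * H + l' * (4 * β ^ 2) * H)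
      ≤ U ^ 2 + l ^ 2 * β ^ 2 + m ^ 2 := by
  set Φ := U ^ 2 + l ^ 2 * β ^ 2 + m ^ 2 with hΦ
  have hHp : H ≤ p * H := le_mul_of_one_le_left hH hp
  have hma : m ^ 2 * α ^ 2 ≤ 4 * Φ := sq_mul_sq_le_four_mul hm1 hm hU hα hαU
  have hlb : l ^ 2 * β ^ 2 ≤ Φ := by nlinarith [sq_nonneg U, sq_nonneg m]
  have h0 : 0 ≤ p * H := by positivity
  have t1 : p * H * (2 * U * β) ≤ Φ / 100 := by
    calc p * H * (2 * U * β) ≤ l / 100 * (2 * U * β) := by gcongr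
      _ ≤ Φ / 100 := by nlinarith [sq_nonneg (U - l * β), sq_nonneg m]
  have t2 : p * H * (H * β ^ 2) ≤ Φ / 100 := by
    calc p * H * (H * β ^ 2) ≤ l / 100 * (l / 100 * β ^ 2) := by gcongr; linarith
      _ ≤ Φ / 100 := by nlinarith [sq_nonneg (l * β)]
  have t3 : p * H * (3 * l ^ 2 * (2 * β * α)) ≤ 15 * (Φ / 100) := by
    calc p * H * (3 * l ^ 2 * (2 * β * α)) ≤ m / 100 * (3 * (l * 1) * (2 * β * α)) := by
          rw [pow_two]; gcongr
      _ ≤ 15 * (Φ / 100) := by nlinarith [sq_nonneg (l * β - m * α)]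
  have t4 : p * H * (3 * l ^ 2 * (2 * H * α ^ 2)) ≤ Φ / 100 := by
    calc p * H * (3 * l ^ 2 * (2 * H * α ^ 2))
        ≤ m / 100 * (3 * 1 ^ 2 * (2 * (m / 100) * α ^ 2)) := by gcongr; linarith
      _ ≤ Φ / 100 := by nlinarith
  have t5 : p * H * (3 * l ^ 2 * (4 * β ^ 2)) ≤ 12 * (Φ / 100) := by
    calc p * H * (3 * l ^ 2 * (4 * β ^ 2)) ≤ 1 / 100 * (3 * l ^ 2 * (4 * β ^ 2)) := by
          gcongr; linarith
      _ ≤ _ := by nlinarith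
  have hΦ0 : 0 ≤ Φ := by positivity
  calc p * ((2 * U * β + H * β ^ 2) * H
      + l' * (2 * β * α + 2 * H * α ^ 2) * H + l' * (4 * β ^ 2) * H)
      ≤ p * ((2 * U * β + H * β ^ 2) * H
      + 3 * l ^ 2 * (2 * β * α + 2 * H * α ^ 2) * H + 3 * l ^ 2 * (4 * β ^ 2) * H) := by gcongr
    _ = p * H * (2 * U * β) + p * H * (H * β ^ 2) + p * H * (3 * l ^ 2 * (2 * β * α))
      + p * H * (3 * l ^ 2 * (2 * H * α ^ 2)) + p * H * (3 * l ^ 2 * (4 * β ^ 2)) := by ring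
    _ ≤ Φ := by linarith

/-- Terms carrying `β²` are charged to the dissipation `Q = δ l² β²`, of which a quarter is
available. What remains is proportional to `Φ` and becomes the growth rate. -/
theorem drift_bound_le (hU : 0 ≤ U) (hβ : 0 ≤ β) (hα : 0 ≤ α) (hαU : α ≤ 1 + U)
    (hl : 0 < l) (hl1 : l ≤ 1) (hm : 0 < m) (hm1 : m ≤ 1) (hl0 : 0 ≤ l') (hl' : l' ≤ 3 * l ^ 2)
    (hp : 1 ≤ p) (hH : 0 ≤ H) (hB : 0 ≤ B) (hδ : 0 < δ)
    (c1 : p * H ≤ l / 100) (c2 : p * H ≤ m / 100)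
    (c3 : 40000 * (p * B) ≤ δ * l ^ 2) (c4 : 40000 * (p * l ^ 2 * B) ≤ δ * m ^ 2) {Φ : ℝ}
    (hΦ : Φ = U ^ 2 + l ^ 2 * β ^ 2 + m ^ 2) :
    (2 * U * β * B + 2 * B * β ^ 2 + l' * (2 * β * (α + β) * B + 4 * B * (α ^ 2 + β ^ 2)))
      + p / Φ * (6 * B * ((2 * U * β + H * β ^ 2) ^ 2
        + (l' * (2 * β * α + 2 * H * α ^ 2)) ^ 2 + (l' * (4 * β ^ 2)) ^ 2))
      ≤ δ / 4 * l ^ 2 * β ^ 2 + 100 * (B ^ 2 / (δ * l ^ 2) + l ^ 2 * B / m ^ 2) * Φ := by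
  have hp0 : 0 < p := by linarith
  have hHp : H ≤ p * H := le_mul_of_one_le_left hH hp
  have hma : m ^ 2 * α ^ 2 ≤ 4 * Φ := by
    rw [hΦ]; exact sq_mul_sq_le_four_mul hm1 hm hU hα hαU
  have hma' : α ^ 2 ≤ 4 * Φ / m ^ 2 := by rw [le_div_iff₀ (by positivity)]; linarith
  have hlb : l ^ 2 * β ^ 2 ≤ Φ := by rw [hΦ]; nlinarith [sq_nonneg U, sq_nonneg m]
  have hUΦ : U ^ 2 ≤ Φ := by rw [hΦ]; nlinarith [sq_nonneg (l * β), sq_nonneg m]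
  have hΦ0 : 0 < Φ := by rw [hΦ]; positivity
  have hl2 : l ^ 2 ≤ 1 := by nlinarith
  have hm2 : m ^ 2 ≤ 1 := by nlinarith
  set G1 := B ^ 2 / (δ * l ^ 2) with hG1
  set G2 := l ^ 2 * B / m ^ 2 with hG2
  have hG1' : G1 * (δ * l ^ 2) = B ^ 2 := by rw [hG1]; field_simp
  have hG10 : 0 ≤ G1 := by positivity
  have hG20 : 0 ≤ G2 := by positivity
  set Q := δ * l ^ 2 * β ^ 2 with hQ
  have hQ0 : 0 ≤ Q := by positivity
  have hpB : p * B * β ^ 2 ≤ Q / 40000 := by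
    have := mul_le_mul_of_nonneg_right c3 (sq_nonneg β); linarith
  have hBβ : B * β ^ 2 ≤ Q / 40000 := by
    refine le_trans ?_ hpB
    rw [mul_assoc]
    exact le_mul_of_one_le_left (by positivity) hp
  have hlBβ : l ^ 2 * (B * β ^ 2) ≤ Q / 40000 := by
    refine le_trans ?_ hBβ
    exact mul_le_of_le_one_left (by positivity) hl2
  have hlBα : l ^ 2 * B * α ^ 2 ≤ 4 * (G2 * Φ) := by
    calc l ^ 2 * B * α ^ 2 ≤ l ^ 2 * B * (4 * Φ / m ^ 2) := by gcongr
      _ = 4 * (G2 * Φ) := by rw [hG2]; ring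
  -- Young's inequality with weight `δ l²`; this is the origin of the term `B² / (δ l²)`.
  have hUβ : 2 * U * β * B ≤ Q / 100 + 100 * (G1 * Φ) := by
    have h1 : 2 * U * β * B ≤ Q / 100 + 100 * (G1 * U ^ 2) := by
      have hd : 0 < δ * l ^ 2 := by positivity
      refine le_of_mul_le_mul_left ?_ hd
      have : δ * l ^ 2 * (100 * (G1 * U ^ 2)) = 100 * B ^ 2 * U ^ 2 := by
        rw [← hG1']; ring
      rw [mul_add, this, hQ]
      linarith [sq_nonneg (δ * l ^ 2 * β / 10 - 10 * (B * U))]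
    have h2 : G1 * U ^ 2 ≤ G1 * Φ := by gcongr
    linarith
  have drift : 2 * U * β * B + 2 * B * β ^ 2
      + l' * (2 * β * (α + β) * B + 4 * B * (α ^ 2 + β ^ 2))
      ≤ Q / 50 + 100 * (G1 * Φ) + 60 * (G2 * Φ) := by
    have h1 : l' * (2 * β * (α + β) * B + 4 * B * (α ^ 2 + β ^ 2))
        ≤ 15 * (l ^ 2 * B * α ^ 2) + 21 * (l ^ 2 * (B * β ^ 2)) := by
      calc l' * (2 * β * (α + β) * B + 4 * B * (α ^ 2 + β ^ 2))
          ≤ 3 * l ^ 2 * (2 * β * (α + β) * B + 4 * B * (α ^ 2 + β ^ 2)) := by gcongr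
        _ ≤ _ := by
          have : 0 ≤ l ^ 2 * B * (α - β) ^ 2 := by positivity
          linarith
    linarith
  have hsq1 : p / Φ * (B * (2 * U * β + H * β ^ 2) ^ 2) ≤ 10 * (Q / 40000) := by
    have h1 : (2 * U * β + H * β ^ 2) ^ 2 ≤ 10 * β ^ 2 * Φ := by
      have : (H * β ^ 2) ^ 2 ≤ β ^ 2 * Φ := by
        calc (H * β ^ 2) ^ 2 = H ^ 2 * β ^ 2 * β ^ 2 := by ring
          _ ≤ l ^ 2 * β ^ 2 * β ^ 2 := by gcongr; linarith
          _ ≤ Φ * β ^ 2 := by gcongr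
          _ = _ := by ring
      have h2 : U ^ 2 * β ^ 2 ≤ Φ * β ^ 2 := by gcongr
      linarith [sq_nonneg (2 * U * β - H * β ^ 2)]
    calc p / Φ * (B * (2 * U * β + H * β ^ 2) ^ 2) ≤ p / Φ * (B * (10 * β ^ 2 * Φ)) := by gcongr
      _ = 10 * (p * B * β ^ 2) := by field_simp
      _ ≤ _ := by linarith
  have hl'2 : l' ^ 2 ≤ 9 * (l ^ 2) ^ 2 := by
    calc l' ^ 2 ≤ (3 * l ^ 2) ^ 2 := by gcongr
      _ = _ := by ring
  have hsq2 : p / Φ * (B * (l' * (2 * β * α + 2 * H * α ^ 2)) ^ 2)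
      ≤ 288 * (Q / 40000) + G2 * Φ / 8 := by
    have h1 : (2 * β * α + 2 * H * α ^ 2) ^ 2 ≤ (8 * β ^ 2 + 8 * H ^ 2 * α ^ 2) * (4 * Φ / m ^ 2) := by
      calc (2 * β * α + 2 * H * α ^ 2) ^ 2 ≤ (8 * β ^ 2 + 8 * H ^ 2 * α ^ 2) * α ^ 2 := by
            linarith [sq_nonneg (2 * β * α - 2 * H * α ^ 2)]
        _ ≤ _ := by gcongr
    have h2 : p * H ^ 2 / m ^ 2 ≤ 1 / 10000 := by
      rw [div_le_iff₀ (by positivity)]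
      calc p * H ^ 2 = (p * H) * H := by ring
        _ ≤ m / 100 * (m / 100) := by gcongr; linarith
        _ = _ := by ring
    have h3 : p * B * (l ^ 2) ^ 2 * β ^ 2 / m ^ 2 ≤ Q / 40000 := by
      rw [div_le_iff₀ (by positivity)]
      have := mul_le_mul_of_nonneg_right c4 (by positivity : 0 ≤ l ^ 2 * β ^ 2)
      rw [hQ]; linarith
    calc p / Φ * (B * (l' * (2 * β * α + 2 * H * α ^ 2)) ^ 2)
        = p / Φ * (B * (l' ^ 2 * (2 * β * α + 2 * H * α ^ 2) ^ 2)) := by rw [mul_pow]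
      _ ≤ p / Φ * (B * (9 * (l ^ 2) ^ 2 *
          ((8 * β ^ 2 + 8 * H ^ 2 * α ^ 2) * (4 * Φ / m ^ 2)))) := by gcongr
      _ = 288 * (p * B * (l ^ 2) ^ 2 * β ^ 2 / m ^ 2)
          + 288 * (p * H ^ 2 / m ^ 2) * l ^ 2 * (l ^ 2 * B * α ^ 2) := by
            field_simp; ring
      _ ≤ 288 * (Q / 40000) + 288 * (1 / 10000) * 1 * (4 * (G2 * Φ)) := by gcongr
      _ ≤ _ := by
        have : 0 ≤ G2 * Φ := by positivity
        linarith
  have hsq3 : p / Φ * (B * (l' * (4 * β ^ 2)) ^ 2) ≤ 144 * (Q / 40000) := by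
    calc p / Φ * (B * (l' * (4 * β ^ 2)) ^ 2)
        = p / Φ * (B * (16 * (l' ^ 2) * β ^ 2 * β ^ 2)) := by ring
      _ ≤ p / Φ * (B * (16 * (9 * (l ^ 2) ^ 2) * β ^ 2 * β ^ 2)) := by gcongr
      _ = 144 * (p / Φ * (B * β ^ 2 * l ^ 2 * (l ^ 2 * β ^ 2))) := by ring
      _ ≤ 144 * (p / Φ * (B * β ^ 2 * 1 * Φ)) := by gcongr
      _ = 144 * (p * B * β ^ 2) := by field_simp
      _ ≤ _ := by linarith
  have e : p / Φ * (6 * B * ((2 * U * β + H * β ^ 2) ^ 2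
        + (l' * (2 * β * α + 2 * H * α ^ 2)) ^ 2 + (l' * (4 * β ^ 2)) ^ 2))
      = 6 * (p / Φ * (B * (2 * U * β + H * β ^ 2) ^ 2)
        + p / Φ * (B * (l' * (2 * β * α + 2 * H * α ^ 2)) ^ 2)
        + p / Φ * (B * (l' * (4 * β ^ 2)) ^ 2)) := by ring
  rw [e]
  have : 0 ≤ G2 * Φ := by positivity
  have hQ' : δ / 4 * l ^ 2 * β ^ 2 = Q / 4 := by rw [hQ]; ring
  rw [hQ']
  linarith

end Algebra

/-- One step of the recursion multiplies the `p`-th moment of the quadratic potential by at most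
`exp (p g)`, where `g = 100 (B² / (δ λ) + λ B / κ)`. -/
theorem lintegral_potential_step_le {S : Type*} [MeasurableSpace S] {P : Measure S}
    [IsProbabilityMeasure P] {x y z : S → ℂ} {B H p δ κ lam lam' : ℝ} {ρ : ℂ}
    (hx : Measurable x) (hy : Measurable y) (hz : Measurable z)
    (bx : ∀ᵐ s ∂P, ‖x s‖ ≤ H) (hb : ∀ᵐ s ∂P, ‖y s‖ ≤ H) (bz : ∀ᵐ s ∂P, ‖z s‖ ≤ H)
    (ex : ‖∫ s, x s ∂P‖ ≤ B) (ey : ‖∫ s, y s ∂P‖ ≤ B) (ez : ‖∫ s, z s ∂P‖ ≤ B)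
    (vx : ∫ s, ‖x s‖ ^ 2 ∂P ≤ 2 * B) (vy : ∫ s, ‖y s‖ ^ 2 ∂P ≤ 2 * B)
    (vz : ∫ s, ‖z s‖ ^ 2 ∂P ≤ 2 * B)
    (hlam : 0 < lam) (hlam1 : lam ≤ 1) (hκ : 0 < κ) (hκ1 : κ ≤ 1)
    (hlam0 : 0 ≤ lam') (hlam' : lam' ≤ 3 * lam)
    (hp : 1 ≤ p) (hH : 0 ≤ H) (hδ : 0 < δ) (hρ : ‖ρ‖ ≤ 1)
    (c1 : p * H ≤ √lam / 100) (c2 : p * H ≤ √κ / 100)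
    (c3 : 40000 * (p * B) ≤ δ * lam) (c4 : 40000 * (p * lam * B) ≤ δ * κ)
    (hdiss : δ / 4 * lam ≤ lam - lam' * ‖ρ‖ ^ 2) (e u b : ℂ) (he : ‖e‖ ≤ 1) :
    ∫⁻ s, ENNReal.ofReal ((‖u + x s * b‖ ^ 2
        + lam' * ‖y s * (e + u) + (ρ - z s) * b‖ ^ 2 + κ) ^ p) ∂P
      ≤ ENNReal.ofReal ((‖u‖ ^ 2 + lam * ‖b‖ ^ 2 + κ) ^ p
        * Real.exp (p * (100 * (B ^ 2 / (δ * lam) + lam * B / κ)))) := by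
  set Φ := ‖u‖ ^ 2 + lam * ‖b‖ ^ 2 + κ with hΦ
  have hp0 : 0 < p := by linarith
  have hΦ0 : 0 < Φ := by positivity
  have B0 : 0 ≤ B := (norm_nonneg _).trans ex
  have hl2 : √lam ^ 2 = lam := Real.sq_sqrt hlam.le
  have hm2 : √κ ^ 2 = κ := Real.sq_sqrt hκ.le
  have hl : 0 < √lam := Real.sqrt_pos.2 hlam
  have hm : 0 < √κ := Real.sqrt_pos.2 hκ
  have hl1 : √lam ≤ 1 := Real.sqrt_le_one.2 hlam1
  have hm1 : √κ ≤ 1 := Real.sqrt_le_one.2 hκ1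
  have H1 : H ≤ 1 := by
    have := le_mul_of_one_le_left hH hp
    linarith
  have hv : ‖ρ * b‖ ≤ ‖b‖ := by
    rw [norm_mul]; exact mul_le_of_le_one_left (norm_nonneg _) hρ
  have hα : ‖e + u‖ ≤ 1 + ‖u‖ := (norm_add_le _ _).trans (by gcongr)
  set F : S → ℝ := fun s => fluctuation lam' u (e + u) (ρ * b) b (x s) (y s) (z s) with hF
  have mF : Measurable F := measurable_fluctuation hx hy hz _ _ _ _ _
  set Y : S → ℝ := fun s => p / Φ * F s with hY
  have hYle : ∀ᵐ s ∂P, |Y s| ≤ 1 := by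
    filter_upwards [bx, hb, bz] with s h1 h2 h3
    have h := abs_fluctuation_le (u := u) (a := e + u) hlam0 H1 hv h1 h2 h3
    have h' := fluctuation_bound_le (l' := lam') (norm_nonneg u) (norm_nonneg b)
      (norm_nonneg (e + u)) hα hl hl1 hm hm1 (by rwa [hl2]) hp hH c1 c2
    rw [hl2, hm2] at h'
    rw [hY]
    show |p / Φ * F s| ≤ 1
    rw [abs_mul, abs_of_nonneg (by positivity), div_mul_eq_mul_div, div_le_one hΦ0]
    refine le_trans ?_ h'
    refine mul_le_mul_of_nonneg_left (h.trans ?_) hp0.le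
    gcongr
  have hD : ∫ s, Y s ∂P + ∫ s, Y s ^ 2 ∂P
      ≤ p / Φ * ((lam - lam' * ‖ρ‖ ^ 2) * ‖b‖ ^ 2)
        + p * (100 * (B ^ 2 / (δ * lam) + lam * B / κ)) := by
    have i1 := integral_fluctuation_le hlam0 hx hy hz bx hb bz ex ey ez vx vy vz
      (u := u) (a := e + u) hv
    have i2 := integral_fluctuation_sq_le hlam0 H1 hx hy hz bx hb bz vx vy vz
      (u := u) (a := e + u) hv
    have i3 := drift_bound_le (l' := lam') (norm_nonneg u) (norm_nonneg b)
      (norm_nonneg (e + u)) hα hl hl1 hm hm1 hlam0 (by rwa [hl2]) hp hH B0 hδ c1 c2 (by rwa [hl2]) (by rwa [hl2, hm2])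
      (Φ := Φ) (by rw [hl2, hm2])
    rw [hl2, hm2] at i3
    simp only [hY, mul_pow]
    rw [integral_const_mul, integral_const_mul]
    calc p / Φ * ∫ s, F s ∂P + (p / Φ) ^ 2 * ∫ s, F s ^ 2 ∂P
        = p / Φ * (∫ s, F s ∂P + p / Φ * ∫ s, F s ^ 2 ∂P) := by ring
      _ ≤ p / Φ * (δ / 4 * lam * ‖b‖ ^ 2 + 100 * (B ^ 2 / (δ * lam) + lam * B / κ) * Φ) := by
        refine mul_le_mul_of_nonneg_left ?_ (by positivity)
        refine le_trans ?_ i3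
        exact add_le_add i1 (mul_le_mul_of_nonneg_left i2 (by positivity))
      _ ≤ p / Φ * ((lam - lam' * ‖ρ‖ ^ 2) * ‖b‖ ^ 2
          + 100 * (B ^ 2 / (δ * lam) + lam * B / κ) * Φ) := by gcongr
      _ = _ := by field_simp
  -- The potential changes by the fluctuation minus a deterministic loss. `D` is that loss, rescaled
  -- by `p / Φ`; it cancels the `‖b‖²` term in `hD`, leaving only the growth.
  set D := p / Φ * ((lam - lam' * ‖ρ‖ ^ 2) * ‖b‖ ^ 2) with hDdef
  have pt : ∀ s, (‖u + x s * b‖ ^ 2 + lam' * ‖y s * (e + u) + (ρ - z s) * b‖ ^ 2 + κ) ^ p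
      ≤ Φ ^ p * Real.exp (-D) * Real.exp (Y s) := by
    intro s
    refine (rpow_le_rpow_mul_exp hΦ0 (by positivity) hp0.le).trans (le_of_eq ?_)
    rw [mul_assoc, ← Real.exp_add]
    congr 2
    have : y s * (e + u) + (ρ - z s) * b = ρ * b + (y s * (e + u) - z s * b) := by ring
    rw [this, hDdef, hY, hF, hΦ]
    simp only [fluctuation, norm_mul]
    ring
  calc _ ≤ ∫⁻ s, ENNReal.ofReal (Φ ^ p * Real.exp (-D)) * ENNReal.ofReal (Real.exp (Y s)) ∂P := by
        refine lintegral_mono fun s => ?_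
        rw [← ENNReal.ofReal_mul (by positivity)]
        exact ENNReal.ofReal_le_ofReal (pt s)
    _ = ENNReal.ofReal (Φ ^ p * Real.exp (-D)) * ∫⁻ s, ENNReal.ofReal (Real.exp (Y s)) ∂P :=
        lintegral_const_mul' _ _ ENNReal.ofReal_ne_top
    _ ≤ ENNReal.ofReal (Φ ^ p * Real.exp (-D))
        * ENNReal.ofReal (Real.exp (∫ s, Y s ∂P + ∫ s, Y s ^ 2 ∂P)) := by
        gcongr
        exact lintegral_exp_le_of_abs_le_one (mF.const_mul _) hYle
    _ ≤ _ := by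
        rw [← ENNReal.ofReal_mul (by positivity), mul_assoc, ← Real.exp_add]
        refine ENNReal.ofReal_le_ofReal ?_
        gcongr
        linarith

/-! ### Independence and iteration of the one-step bound -/

section Chain

theorem measurable_matrix_iff {T : Type*} [MeasurableSpace T]
    {f : T → Matrix (Fin 2) (Fin 2) ℂ} :
    Measurable f ↔ ∀ i j, Measurable fun t => f t i j := by
  refine (measurable_pi_iff (X := fun _ : Fin 2 => Fin 2 → ℂ)).trans (forall_congr' fun i => ?_)
  exact measurable_pi_iff

theorem measurable_matrix_apply (i j : Fin 2) :
    Measurable fun M : Matrix (Fin 2) (Fin 2) ℂ => M i j :=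
  measurable_matrix_iff.1 measurable_id i j

theorem Measurable.matrix_mul {T : Type*} [MeasurableSpace T]
    {f g : T → Matrix (Fin 2) (Fin 2) ℂ} (hf : Measurable f) (hg : Measurable g) :
    Measurable fun t => f t * g t := by
  rw [measurable_matrix_iff] at *
  intro i j
  simp only [Matrix.mul_apply]
  exact Finset.measurable_sum _ fun k _ => (hf i k).mul (hg k j)

theorem orderedProd_congr {U V : ℕ → Matrix (Fin 2) (Fin 2) ℂ} {n : ℕ}
    (h : ∀ k ∈ Finset.Icc 1 n, U k = V k) : orderedProd U n = orderedProd V n := by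
  induction n with
  | zero => rfl
  | succ n ih =>
    simp only [orderedProd]
    rw [h (n + 1) (by simp), ih fun k hk => h k ?_]
    simp only [Finset.mem_Icc] at hk ⊢
    omega

theorem measurable_orderedProd {T : Type*} [MeasurableSpace T]
    {U : ℕ → T → Matrix (Fin 2) (Fin 2) ℂ} {n : ℕ}
    (h : ∀ k ∈ Finset.Icc 1 n, Measurable (U k)) :
    Measurable fun t => orderedProd (fun k => U k t) n := by
  induction n with
  | zero => exact measurable_const
  | succ n ih =>
    refine (h (n + 1) (by simp)).matrix_mul (ih fun k hk => h k ?_)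
    simp only [Finset.mem_Icc] at hk ⊢
    omega

variable {S : Type*} [MeasurableSpace S] {P : Measure S}
  {N : ℕ} {U : ℕ → S → Matrix (Fin 2) (Fin 2) ℂ}

theorem indepFun_orderedProd (hU : ∀ k ∈ Finset.Icc 1 N, Measurable (U k))
    (hind : iIndepFun (fun (k : Finset.Icc 1 N) (s : S) => U k s) P) {n : ℕ} (hn : n < N) :
    IndepFun (fun s => orderedProd (fun k => U k s) n) (U (n + 1)) P := by
  have hmem : n + 1 ∈ Finset.Icc 1 N := by simp; omega
  set A : Finset (Finset.Icc 1 N) := Finset.univ.filter fun k => (k : ℕ) ≤ n with hA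
  have key := hind.indepFun_finset A {⟨n + 1, hmem⟩}
    (by simp [hA]) fun k => hU k k.2
  -- The tuple of factors with index at most `n` is extended to all of `ℕ`. The filler 1 never
  -- enters the product, which uses only the indices `1, …, n`.
  let G : (A → Matrix (Fin 2) (Fin 2) ℂ) → ℕ → Matrix (Fin 2) (Fin 2) ℂ := fun v k =>
    if h : ∃ h' : k ∈ Finset.Icc 1 N, (⟨k, h'⟩ : Finset.Icc 1 N) ∈ A then v ⟨⟨k, h.1⟩, h.2⟩ else 1
  have hG : ∀ k, Measurable fun v => G v k := by
    intro k
    by_cases h : ∃ h' : k ∈ Finset.Icc 1 N, (⟨k, h'⟩ : Finset.Icc 1 N) ∈ A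
    · simp only [G, dif_pos h]
      exact measurable_pi_apply _
    · simp only [G, dif_neg h]
      exact measurable_const
  have m1 : Measurable fun v => orderedProd (G v) n :=
    measurable_orderedProd (U := fun k v => G v k) fun k _ => hG k
  have m2 : Measurable fun v : (({⟨n + 1, hmem⟩} : Finset (Finset.Icc 1 N)) →
      Matrix (Fin 2) (Fin 2) ℂ) => v ⟨⟨n + 1, hmem⟩, by simp⟩ := measurable_pi_apply _
  have := key.comp m1 m2
  convert this using 1
  swap; · rfl
  funext s
  refine orderedProd_congr fun k hk => ?_
  rw [Finset.mem_Icc] at hk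
  have h : ∃ h' : k ∈ Finset.Icc 1 N, (⟨k, h'⟩ : Finset.Icc 1 N) ∈ A :=
    ⟨by rw [Finset.mem_Icc]; omega, by simp [hA, hk.2]⟩
  simp only [G, dif_pos h]

theorem lintegral_orderedProd_succ [IsProbabilityMeasure P]
    (hU : ∀ k ∈ Finset.Icc 1 N, Measurable (U k))
    (hind : iIndepFun (fun (k : Finset.Icc 1 N) (s : S) => U k s) P) {n : ℕ} (hn : n < N)
    {F : Matrix (Fin 2) (Fin 2) ℂ → ENNReal} (hF : Measurable F) :
    ∫⁻ s, F (orderedProd (fun k => U k s) (n + 1)) ∂P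
      = ∫⁻ s, ∫⁻ t, F (U (n + 1) t * orderedProd (fun k => U k s) n) ∂P ∂P := by
  have mU : Measurable (U (n + 1)) := hU _ (by simp; omega)
  have mX : Measurable fun s => orderedProd (fun k => U k s) n :=
    measurable_orderedProd fun k hk => hU k (by simp only [Finset.mem_Icc] at hk ⊢; omega)
  have hmul : Measurable fun q : Matrix (Fin 2) (Fin 2) ℂ × Matrix (Fin 2) (Fin 2) ℂ =>
      F (q.2 * q.1) := hF.comp (measurable_snd.matrix_mul measurable_fst)
  have h := (indepFun_orderedProd hU hind hn).map_prod_eq_prod_map_map mX.aemeasurable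
    mU.aemeasurable
  have : IsProbabilityMeasure (P.map (U (n + 1))) := Measure.isProbabilityMeasure_map mU.aemeasurable
  calc ∫⁻ s, F (orderedProd (fun k => U k s) (n + 1)) ∂P
      = ∫⁻ q, F (q.2 * q.1)
          ∂(P.map fun s => (orderedProd (fun k => U k s) n, U (n + 1) s)) := by
        rw [lintegral_map hmul (mX.prodMk mU)]; rfl
    _ = ∫⁻ M, ∫⁻ M', F (M' * M) ∂(P.map (U (n + 1)))
          ∂(P.map fun s => orderedProd (fun k => U k s) n) := by
        rw [h, lintegral_prod _ hmul.aemeasurable]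
    _ = ∫⁻ s, ∫⁻ M', F (M' * orderedProd (fun k => U k s) n) ∂(P.map (U (n + 1))) ∂P := by
        rw [lintegral_map hmul.lintegral_prod_right' mX]
    _ = _ := by
        refine lintegral_congr fun s => ?_
        exact lintegral_map (hF.comp (measurable_id.matrix_mul measurable_const)) mU

/-- By independence the past product can be frozen, so a bound valid for every deterministic `M`
iterates. Writing the exponents as increments of `Γ` makes the factors telescope. -/
theorem lintegral_orderedProd_le [IsProbabilityMeasure P]
    (hU : ∀ k ∈ Finset.Icc 1 N, Measurable (U k))
    (hind : iIndepFun (fun (k : Finset.Icc 1 N) (s : S) => U k s) P)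
    {F : ℕ → Matrix (Fin 2) (Fin 2) ℂ → ℝ} (hF : ∀ n, Measurable (F n))
    {Γ : ℕ → ℝ} (hstep : ∀ n < N, ∀ M, ∫⁻ s, ENNReal.ofReal (F (n + 1) (U (n + 1) s * M)) ∂P
      ≤ ENNReal.ofReal (F n M * Real.exp (Γ (n + 1) - Γ n))) :
    ∀ n ≤ N, ∫⁻ s, ENNReal.ofReal (F n (orderedProd (fun k => U k s) n)) ∂P
      ≤ ENNReal.ofReal (F 0 1 * Real.exp (Γ n - Γ 0)) := by
  intro n
  induction n with
  | zero => simp [orderedProd]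
  | succ n ih =>
    intro hn
    rw [lintegral_orderedProd_succ (F := fun M => ENNReal.ofReal (F (n + 1) M)) hU hind
      (by omega) (hF _).ennreal_ofReal]
    calc _ ≤ ∫⁻ s, ENNReal.ofReal (F n (orderedProd (fun k => U k s) n))
            * ENNReal.ofReal (Real.exp (Γ (n + 1) - Γ n)) ∂P := by
          refine lintegral_mono fun s => ?_
          rw [← ENNReal.ofReal_mul' (Real.exp_pos _).le]
          exact hstep n (by omega) _
      _ = (∫⁻ s, ENNReal.ofReal (F n (orderedProd (fun k => U k s) n)) ∂P)
            * ENNReal.ofReal (Real.exp (Γ (n + 1) - Γ n)) :=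
          lintegral_mul_const' _ _ ENNReal.ofReal_ne_top
      _ ≤ ENNReal.ofReal (F 0 1 * Real.exp (Γ n - Γ 0))
            * ENNReal.ofReal (Real.exp (Γ (n + 1) - Γ n)) := by
          gcongr; exact ih (by omega)
      _ = _ := by
          rw [← ENNReal.ofReal_mul' (Real.exp_pos _).le, mul_assoc, ← Real.exp_add]
          congr 3; ring

end Chain

theorem measurable_hypMatrix {S : Type*} [MeasurableSpace S] {ρ : ℂ}
    {η : Fin 2 → Fin 2 → S → ℂ} (h : ∀ i j, (i, j) ≠ (0, 0) → Measurable (η i j)) :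
    Measurable fun s => hypMatrix ρ fun i j => η i j s := by
  have h1 := h 0 1 (by simp)
  have h2 := h 1 0 (by simp)
  have h3 := h 1 1 (by simp)
  rw [measurable_matrix_iff]
  intro i j
  fin_cases i <;> fin_cases j <;> simp [hypMatrix] <;> fun_prop

/-- Cauchy–Schwarz in each row. The Frobenius sum is grouped by columns because the columns are
estimated separately. -/
theorem opNorm_sq_le (M : Matrix (Fin 2) (Fin 2) ℂ) :
    opNorm M ^ 2 ≤ (‖M 0 0‖ ^ 2 + ‖M 1 0‖ ^ 2) + (‖M 0 1‖ ^ 2 + ‖M 1 1‖ ^ 2) := by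
  set F := (‖M 0 0‖ ^ 2 + ‖M 1 0‖ ^ 2) + (‖M 0 1‖ ^ 2 + ‖M 1 1‖ ^ 2) with hF
  have hF0 : 0 ≤ F := by positivity
  have : opNorm M ≤ √F := by
    refine ContinuousLinearMap.opNorm_le_bound _ (Real.sqrt_nonneg _) fun x => ?_
    rw [EuclideanSpace.norm_eq, EuclideanSpace.norm_eq, ← Real.sqrt_mul hF0]
    refine Real.sqrt_le_sqrt ?_
    simp only [Matrix.ofLp_toEuclideanCLM, Matrix.mulVec, dotProduct, Fin.sum_univ_two]
    have cs : ∀ a b x y : ℂ, ‖a * x + b * y‖ ^ 2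
        ≤ (‖a‖ ^ 2 + ‖b‖ ^ 2) * (‖x‖ ^ 2 + ‖y‖ ^ 2) := by
      intro a b x y
      have h1 : ‖a * x + b * y‖ ≤ ‖a‖ * ‖x‖ + ‖b‖ * ‖y‖ := by
        simpa using norm_add_le (a * x) (b * y)
      have h2 : ‖a * x + b * y‖ ^ 2 ≤ (‖a‖ * ‖x‖ + ‖b‖ * ‖y‖) ^ 2 := by gcongr
      nlinarith [sq_nonneg (‖a‖ * ‖y‖ - ‖b‖ * ‖x‖)]
    have h1 := cs (M 0 0) (M 0 1) (x 0) (x 1)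
    have h2 := cs (M 1 0) (M 1 1) (x 0) (x 1)
    rw [hF]
    linarith
  calc opNorm M ^ 2 ≤ √F ^ 2 := by
        gcongr
        exact norm_nonneg _
    _ = F := Real.sq_sqrt hF0

/-! ### The time-dependent weight and its total growth -/

section Weights

variable {A C R κ ω n L d w E δ p : ℝ}

/-- Discrete derivative of `w ↦ w^(-1/2)`. As `√(w+1) ≤ (3/2) √w`, the constant needed is
`(3/2)(5/2) = 15/4 ≤ 4`. -/
theorem sqrt_inv_telescope (hω : 0 < ω) (hw : 1 ≤ w) :
    √ω / (w * √w) ≤ 4 * (√(ω / w) - √(ω / (w + 1))) := by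
  have hw0 : 0 < w := by linarith
  rw [Real.sqrt_div hω.le, Real.sqrt_div hω.le]
  set a := √w with ha
  set b := √(w + 1) with hb
  have ha0 : 0 < a := Real.sqrt_pos.2 hw0
  have hb0 : 0 < b := Real.sqrt_pos.2 (by linarith)
  have ha2 : a ^ 2 = w := Real.sq_sqrt hw0.le
  have hb2 : b ^ 2 = w + 1 := Real.sq_sqrt (by linarith)
  have hab : a ≤ b := Real.sqrt_le_sqrt (by linarith)
  have hb' : b ≤ 3 / 2 * a := by nlinarith
  have e : 1 / a - 1 / b = 1 / (a * b * (a + b)) := by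
    field_simp
    nlinarith
  have h : 1 / (w * a) ≤ 4 * (1 / a - 1 / b) := by
    rw [e, ← ha2, ← div_eq_mul_one_div, div_le_div_iff₀ (by positivity) (by positivity)]
    have h1 : b * (a + b) ≤ 3 / 2 * a * (a + 3 / 2 * a) := by gcongr
    have := mul_le_mul_of_nonneg_left h1 ha0.le
    have h3 : 0 < a ^ 3 := by positivity
    linarith
  have := mul_le_mul_of_nonneg_left h (Real.sqrt_nonneg ω)
  calc √ω / (w * a) = √ω * (1 / (w * a)) := by ring
    _ ≤ _ := this
    _ = _ := by ring

/-- The weight of the second coordinate in the potential. -/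
noncomputable def potWeight (A κ ω w E : ℝ) : ℝ := A * κ * (ω / w) + 1 / (2 * A) * E

theorem potWeight_pos (hA : 0 < A) (hκ : 0 < κ) (hω : 0 < ω) (hw : 0 < w) (hE : 0 < E) :
    0 < potWeight A κ ω w E := by
  unfold potWeight; positivity

theorem potWeight_ge (hA : 1 ≤ A) (hκ : 0 < κ) (hω : 0 < ω) (hw : 1 ≤ w) (hE : 0 < E) :
    A * κ * ω ≤ 2 * w * potWeight A κ ω (w + 1) E := by
  have hA0 : 0 < A := by linarith
  have hw0 : 0 < w := by linarith
  have h : ω ≤ 2 * w * (ω / (w + 1)) := by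
    rw [← mul_div_assoc, le_div_iff₀ (by positivity)]
    nlinarith
  have h2 := mul_le_mul_of_nonneg_left h (mul_pos hA0 hκ).le
  have h3 : 0 ≤ 2 * w * (1 / (2 * A) * E) := by positivity
  unfold potWeight
  linarith

theorem mul_potWeight_le_one (hA : 1 ≤ A) (hκA : κ ≤ 1 / (2 * A ^ 2)) (hω : 0 < ω)
    (hw : ω ≤ w) (hE1 : E ≤ 1) : A * potWeight A κ ω w E ≤ 1 := by
  have hA0 : 0 < A := by linarith
  have hw0 : 0 < w := by linarith
  have h1 : ω / w ≤ 1 := (div_le_one hw0).2 hw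
  calc A * potWeight A κ ω w E ≤ A * (A * (1 / (2 * A ^ 2)) * 1 + 1 / (2 * A) * 1) := by
        unfold potWeight
        gcongr
    _ = 1 := by field_simp; norm_num

/-- Both terms of the weight grow by at most `exp (δ/2)` per step, which uses up only part of the
contraction `exp (-2δ)` of `‖b‖²`. -/
theorem potWeight_succ_le (hA : 0 < A) (hκ : 0 < κ) (hω : 0 < ω) (hw : 0 < w) (hE : 0 < E)
    (hd : d ≤ δ) (hwδ : 2 ≤ w * δ) :
    potWeight A κ ω w (E * Real.exp (d / 2))
      ≤ Real.exp (δ / 2) * potWeight A κ ω (w + 1) E := by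
  have h1 : ω / w ≤ Real.exp (δ / 2) * (ω / (w + 1)) := by
    have h2 : 1 + 1 / w ≤ Real.exp (δ / 2) := by
      refine le_trans ?_ (Real.add_one_le_exp _)
      have : 1 / w ≤ δ / 2 := by rw [div_le_div_iff₀ hw (by norm_num)]; linarith
      linarith
    calc ω / w = (1 + 1 / w) * (ω / (w + 1)) := by field_simp
      _ ≤ _ := by gcongr
  calc potWeight A κ ω w (E * Real.exp (d / 2))
      ≤ A * κ * (Real.exp (δ / 2) * (ω / (w + 1))) + 1 / (2 * A) * (E * Real.exp (δ / 2)) := by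
        unfold potWeight; gcongr
    _ = _ := by unfold potWeight; ring

theorem dissipation_le {r lam lam' : ℝ} (hlam : 0 < lam) (hlam' : lam' ≤ Real.exp (δ / 2) * lam)
    (hδ : 0 ≤ δ) (hδ2 : δ ≤ 2) (hr0 : 0 ≤ r) (hr : r ≤ Real.exp (-δ)) :
    δ / 4 * lam ≤ lam - lam' * r ^ 2 := by
  have h1 : lam' * r ^ 2 ≤ Real.exp (-(3 / 2 * δ)) * lam := by
    calc lam' * r ^ 2 ≤ Real.exp (δ / 2) * lam * Real.exp (-δ) ^ 2 := by gcongr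
      _ = Real.exp (δ / 2) * Real.exp (-δ) ^ 2 * lam := by ring
      _ = _ := by
        rw [pow_two, ← Real.exp_add, ← Real.exp_add]; congr 2; ring
  have h2 : Real.exp (-(3 / 2 * δ)) ≤ 1 - δ / 4 := by
    rw [Real.exp_neg]
    have h3 := Real.add_one_le_exp (3 / 2 * δ)
    calc (Real.exp (3 / 2 * δ))⁻¹ ≤ (3 / 2 * δ + 1)⁻¹ := by gcongr
      _ ≤ 1 - δ / 4 := by
        rw [inv_le_iff_one_le_mul₀ (by positivity)]
        nlinarith
  have := mul_le_mul_of_nonneg_right h2 hlam.le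
  linarith

/-- Each contribution to the growth is dominated by an increment: `B²/(δλ)` by one of `√(ω/w)`, and
the two terms of `λB/κ` by increments of `ω/w` and of `E`. -/
theorem growth_le (hA : 1 ≤ A) (hC : 0 < C) (hκ : 0 < κ) (hω : 1 ≤ ω) (hn : 0 < n)
    (hLω : ω * √(ω / n) = L) (hp : 1 ≤ κ * L) (hw : ω ≤ w) (hE : 0 < E) :
    100 * ((C / w) ^ 2 / (√(w / n) * potWeight A κ ω (w + 1) E)
        + potWeight A κ ω (w + 1) E * (C / w) / κ)
      ≤ (800 * C ^ 2 * √(ω / w) + 100 * A * C * (ω / w)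
          + 100 * C / A * (E * Real.exp (√(ω / n) / 2)))
        - (800 * C ^ 2 * √(ω / (w + 1)) + 100 * A * C * (ω / (w + 1)) + 100 * C / A * E) := by
  have hω0 : 0 < ω := by linarith
  have hw0 : 0 < w := by linarith
  have hA0 : 0 < A := by linarith
  have hlam := potWeight_pos hA0 hκ hω0 (by linarith : 0 < w + 1) hE
  have hlam2 := potWeight_ge hA hκ hω0 (by linarith : 1 ≤ w) hE
  have t := sqrt_inv_telescope hω0 (by linarith : 1 ≤ w)
  set lam := potWeight A κ ω (w + 1) E with hlamdef
  have hδ : 0 < √(w / n) := Real.sqrt_pos.2 (by positivity)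
  have h1 : (C / w) ^ 2 / (√(w / n) * lam) ≤ 2 * C ^ 2 * (√ω / (w * √w)) := by
    have e1 : √(w / n) * √ω = √w * √(ω / n) := by
      rw [Real.sqrt_div hw0.le, Real.sqrt_div hω0.le]; ring
    have hsw : 0 < √w := Real.sqrt_pos.2 hw0
    have key : w * √w ≤ 2 * w ^ 2 * √ω * (√(w / n) * lam) := by
      calc w * √w ≤ w * √w * (κ * L) := le_mul_of_one_le_right (by positivity) hp
        _ = 1 * κ * ω * (w * (√w * √(ω / n))) := by rw [← hLω]; ring
        _ ≤ A * κ * ω * (w * (√w * √(ω / n))) := by gcongr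
        _ ≤ 2 * w * lam * (w * (√w * √(ω / n))) := by gcongr
        _ = _ := by rw [← e1]; ring
    rw [← mul_div_assoc, div_pow, div_div, div_le_div_iff₀ (by positivity) (by positivity)]
    have := mul_le_mul_of_nonneg_left key (sq_nonneg C)
    linarith
  have h2 : lam * (C / w) / κ ≤ A * C * (ω / w - ω / (w + 1))
      + C / A * (E * Real.exp (√(ω / n) / 2) - E) := by
    have e1 : lam * (C / w) / κ = A * C * (ω / w - ω / (w + 1)) + C / (2 * A) * E / (κ * w) := by
      rw [hlamdef, potWeight]; field_simp; ring
    -- Here `κ L ≥ 1` is essential: it bounds `1/(κ w)` by the rate `d` at which `E` grows, so `E/(κ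
    -- w)` is controlled by an increment of `E`.
    have h3 : 1 / (κ * w) ≤ √(ω / n) := by
      rw [div_le_iff₀ (by positivity)]
      calc 1 ≤ κ * L := hp
        _ = √(ω / n) * (κ * ω) := by rw [← hLω]; ring
        _ ≤ _ := by gcongr
    have h4 := Real.add_one_le_exp (√(ω / n) / 2)
    rw [e1]
    gcongr
    calc C / (2 * A) * E / (κ * w) = C / (2 * A) * E * (1 / (κ * w)) := by ring
      _ ≤ C / (2 * A) * E * √(ω / n) := by gcongr
      _ = C / A * (E * (√(ω / n) / 2)) := by field_simp
      _ ≤ C / A * (E * (Real.exp (√(ω / n) / 2) - 1)) := by gcongr; linarith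
      _ = _ := by ring
  have h5 := mul_le_mul_of_nonneg_left t (by positivity : 0 ≤ 200 * C ^ 2)
  calc 100 * ((C / w) ^ 2 / (√(w / n) * lam) + lam * (C / w) / κ)
      ≤ 100 * (2 * C ^ 2 * (√ω / (w * √w)) + (A * C * (ω / w - ω / (w + 1))
      + C / A * (E * Real.exp (√(ω / n) / 2) - E))) := by gcongr
    _ ≤ _ := by
      have : 100 * (C / A * (E * Real.exp (√(ω / n) / 2) - E))
        = 100 * C / A * (E * Real.exp (√(ω / n) / 2)) - 100 * C / A * E := by ring
      linarith

end Weights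

theorem integral_norm_sq_le_complexVar {S : Type*} [MeasurableSpace S] {P : Measure S}
    [IsProbabilityMeasure P] {X : S → ℂ} (hm : Measurable X) {H B : ℝ}
    (hX : ∀ᵐ s ∂P, ‖X s‖ ≤ H) (h1 : ‖∫ s, X s ∂P‖ ≤ B) (h2 : complexVar P X ≤ B) (hB : B ≤ 1) :
    ∫ s, ‖X s‖ ^ 2 ∂P ≤ 2 * B := by
  have i1 : Integrable X P := Integrable.of_bound hm.aestronglyMeasurable H hX
  have i2 : Integrable (fun s => ‖X s‖ ^ 2) P := by
    refine Integrable.of_bound (hm.norm.pow_const 2).aestronglyMeasurable (H ^ 2) ?_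
    filter_upwards [hX] with s hs
    rw [Real.norm_eq_abs, abs_of_nonneg (sq_nonneg _)]
    gcongr
  set m := ∫ s, X s ∂P with hmdef
  have e : complexVar P X = ∫ s, ‖X s‖ ^ 2 ∂P - ‖m‖ ^ 2 := by
    have e1 : (fun s => ‖X s - m‖ ^ 2)
        = fun s => (‖X s‖ ^ 2 - 2 * inner ℝ m (X s)) + ‖m‖ ^ 2 := by
      funext s
      rw [norm_sub_sq_real, real_inner_comm]
    unfold complexVar
    rw [← hmdef, e1, integral_add (by exact i2.sub ((i1.const_inner m).const_mul 2)) (integrable_const _),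
      integral_sub i2 ((i1.const_inner m).const_mul 2), integral_const_mul, integral_inner i1,
      ← hmdef, real_inner_self_eq_norm_sq]
    simp
    ring
  have h3 : ‖m‖ ^ 2 ≤ B := by
    nlinarith [norm_nonneg m]
  linarith

theorem projection_apply_zero (j : Fin 2) :
    (!![1, 0; 0, 0] : Matrix (Fin 2) (Fin 2) ℂ) 0 j = (1 : Matrix (Fin 2) (Fin 2) ℂ) 0 j := by
  rw [Matrix.one_fin_two]
  fin_cases j <;> simp

theorem projection_apply_one (j : Fin 2) :
    (!![1, 0; 0, 0] : Matrix (Fin 2) (Fin 2) ℂ) 1 j = 0 := by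
  fin_cases j <;> simp

/-! ### Moment and tail bounds for the product -/

section Moment

variable {S : Type*} [MeasurableSpace S] {P : Measure S} [IsProbabilityMeasure P]
  {A C R κ ω L : ℝ} {N : ℕ} {ρ : ℕ → ℂ} {η : ℕ → Fin 2 → Fin 2 → S → ℂ}

/-- The one-step moment estimate in the regime of the hyperbolic product. -/
theorem lintegral_hypMatrix_step_le (hC : 0 < C) (hR : 0 < R) (hN : 0 < N) (hω1 : 1 ≤ ω)
    (hCω : C ≤ ω) (hωN : ω ≤ N) (hLω : ω * √(ω / N) = L) (hL2 : 2 ≤ L) (hA : 1 ≤ A)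
    (hAC : 80000 * C ≤ A) (hsmall : 20000 * (R * L ^ 3) ≤ ω) (hκ : 0 < κ)
    (hκA : κ ≤ 1 / (2 * A ^ 2)) (hp : 1 ≤ κ * L) {w E : ℝ} (hw : ω ≤ w) (hwN : w ≤ 2 * N)
    (hE : 0 < E) (hE1 : E ≤ 1) {r : ℂ} {h : Fin 2 → Fin 2 → S → ℂ}
    (hr : ‖r‖ ≤ Real.exp (-√(w / N)))
    (hh : ∀ i j : Fin 2, (i, j) ≠ (0, 0) → Measurable (h i j) ∧
      ‖∫ s, h i j s ∂P‖ ≤ C / w ∧ complexVar P (h i j) ≤ C / w ∧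
      ∀ᵐ s ∂P, ‖h i j s‖ ≤ √(R * L / w)) (e u b : ℂ) (he : ‖e‖ ≤ 1) :
    ∫⁻ s, ENNReal.ofReal ((‖u + h 0 1 s * b‖ ^ 2
        + potWeight A κ ω w (E * Real.exp (√(ω / N) / 2))
          * ‖h 1 0 s * (e + u) + (r - h 1 1 s) * b‖ ^ 2 + κ) ^ (κ * L)) ∂P
      ≤ ENNReal.ofReal ((‖u‖ ^ 2 + potWeight A κ ω (w + 1) E * ‖b‖ ^ 2 + κ) ^ (κ * L)
        * Real.exp (κ * L * (100 * ((C / w) ^ 2 / (√(w / N) * potWeight A κ ω (w + 1) E)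
          + potWeight A κ ω (w + 1) E * (C / w) / κ)))) := by
  have hA0 : 0 < A := by linarith
  have hω0 : 0 < ω := by linarith
  have hw0 : 0 < w := by linarith
  have hL0 : 0 < L := by linarith
  have hN0 : (0 : ℝ) < N := by exact_mod_cast hN
  have hκ1 : κ ≤ 1 := by
    refine hκA.trans ?_
    rw [div_le_one (by positivity)]
    nlinarith
  obtain ⟨m1, a1, v1, b1⟩ := hh 0 1 (by simp)
  obtain ⟨m2, a2, v2, b2⟩ := hh 1 0 (by simp)
  obtain ⟨m3, a3, v3, b3⟩ := hh 1 1 (by simp)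
  have hB1 : C / w ≤ 1 := (div_le_one hw0).2 (by linarith)
  set δ := √(w / N) with hδdef
  have hδ : 0 < δ := Real.sqrt_pos.2 (by positivity)
  have hdδ : √(ω / N) ≤ δ := Real.sqrt_le_sqrt (by gcongr)
  have hδ2 : δ ≤ 2 := by
    rw [hδdef, Real.sqrt_le_left (by norm_num), div_le_iff₀ hN0]
    linarith
  have hωδ : L ≤ ω * δ := by rw [← hLω]; gcongr
  have hwδ : L ≤ w * δ := hωδ.trans (by gcongr)
  set lam := potWeight A κ ω (w + 1) E with hlamdef
  have hlam : 0 < lam := potWeight_pos hA0 hκ hω0 (by linarith) hE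
  have hlam2 : A * κ * ω ≤ 2 * w * lam := potWeight_ge hA hκ hω0 (by linarith) hE
  have hAlam : A * lam ≤ 1 := mul_potWeight_le_one hA hκA hω0 (by linarith) hE1
  have hlam1 : lam ≤ 1 := (le_mul_of_one_le_left hlam.le hA).trans hAlam
  set lam' := potWeight A κ ω w (E * Real.exp (√(ω / N) / 2)) with hlamdef'
  have hlam0 : 0 < lam' := potWeight_pos hA0 hκ hω0 hw0 (by positivity)
  have hlam' : lam' ≤ Real.exp (δ / 2) * lam :=
    potWeight_succ_le hA0 hκ hω0 hw0 hE hdδ (by linarith)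
  have hexp : Real.exp (δ / 2) ≤ 3 := by
    have : Real.exp (δ / 2) ≤ Real.exp 1 := Real.exp_le_exp.2 (by linarith)
    linarith [Real.exp_one_lt_d9]
  have hρ1 : ‖r‖ ≤ 1 := hr.trans (Real.exp_le_one_iff.2 (by linarith))
  have hsq : √(R * L / w) ^ 2 = R * L / w := Real.sq_sqrt (by positivity)
  -- After squaring, the two requirements on `p H` ask that `κ² R L³ / w` be small against `λ` and
  -- against `κ`. Both follow from this inequality, the first through `λ ≥ Aκω/(2w)`.
  have hκRL : 20000 * (κ * (R * L ^ 3)) ≤ κ * ω := by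
    have := mul_le_mul_of_nonneg_left hsmall hκ.le
    linarith
  refine lintegral_potential_step_le m1 m2 m3 b1 b2 b3 a1 a2 a3
    (integral_norm_sq_le_complexVar m1 b1 a1 v1 hB1)
    (integral_norm_sq_le_complexVar m2 b2 a2 v2 hB1)
    (integral_norm_sq_le_complexVar m3 b3 a3 v3 hB1)
    hlam hlam1 hκ hκ1 hlam0.le (hlam'.trans (by gcongr)) hp (Real.sqrt_nonneg _) hδ hρ1
    ?_ ?_ ?_ ?_ (dissipation_le hlam hlam' hδ.le hδ2 (norm_nonneg _) hr) e u b he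
  · rw [le_div_iff₀ (by norm_num)]
    refine Real.le_sqrt_of_sq_le ?_
    rw [mul_pow, mul_pow, hsq]
    have h1 : (κ * L) ^ 2 * (R * L / w) * 100 ^ 2 = 10000 * (κ * (κ * (R * L ^ 3))) / w := by ring
    rw [h1, div_le_iff₀ hw0]
    have h2 : κ * (κ * (R * L ^ 3)) ≤ 1 * (κ * (R * L ^ 3)) := by gcongr
    have h3 : κ * ω ≤ A * (κ * ω) := le_mul_of_one_le_left (by positivity) hA
    linarith
  · rw [le_div_iff₀ (by norm_num)]
    refine Real.le_sqrt_of_sq_le ?_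
    rw [mul_pow, mul_pow, hsq]
    have h1 : (κ * L) ^ 2 * (R * L / w) * 100 ^ 2 = 10000 * (κ * (κ * (R * L ^ 3))) / w := by ring
    rw [h1, div_le_iff₀ hw0]
    have h2 : κ * (κ * (R * L ^ 3)) ≤ 1 * (κ * (R * L ^ 3)) := by gcongr
    have h3 : κ * ω ≤ κ * w := by gcongr
    have h4 : 0 < κ * (R * L ^ 3) := by positivity
    linarith
  · rw [← mul_div_assoc, ← mul_div_assoc, div_le_iff₀ hw0]
    have h1 := mul_le_mul_of_nonneg_left hlam2 hδ.le
    have h2 : 80000 * C * (κ * L) ≤ A * (κ * (ω * δ)) := by gcongr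
    linarith
  · rw [← mul_div_assoc, ← mul_div_assoc, div_le_iff₀ hw0]
    have h1 : 80000 * C * lam ≤ 1 := le_trans (by gcongr) hAlam
    have h2 : 40000 * C * lam * (κ * L) ≤ 1 * (κ * (w * δ)) := by
      have : 0 < C * lam := by positivity
      gcongr
      linarith
    linarith

theorem lintegral_column_le (hC : 0 < C) (hR : 0 < R) (hN : 0 < N) (hω1 : 1 ≤ ω)
    (hCω : C ≤ ω) (hωN : ω ≤ N) (hLω : ω * √(ω / N) = L) (hL2 : 2 ≤ L) (hA : 1 ≤ A)
    (hAC : 80000 * C ≤ A) (hsmall : 20000 * (R * L ^ 3) ≤ ω) (hκ : 0 < κ)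
    (hκA : κ ≤ 1 / (2 * A ^ 2)) (hp : 1 ≤ κ * L)
    (hρ : ∀ k ∈ Finset.Icc 1 N, ‖ρ k‖ ≤ Real.exp (-√((ω + ((N : ℝ) - k)) / N)))
    (hη : ∀ k ∈ Finset.Icc 1 N, ∀ i j : Fin 2, (i, j) ≠ (0, 0) → Measurable (η k i j) ∧
      ‖∫ s, η k i j s ∂P‖ ≤ C / (ω + ((N : ℝ) - k)) ∧
      complexVar P (η k i j) ≤ C / (ω + ((N : ℝ) - k)) ∧
      ∀ᵐ s ∂P, ‖η k i j s‖ ≤ √(R * L / (ω + ((N : ℝ) - k))))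
    (hind : iIndepFun (fun (k : Finset.Icc 1 N) (s : S) =>
      hypMatrix (ρ k) (fun i j => η k i j s)) P) (j : Fin 2) :
    ∫⁻ s, ENNReal.ofReal (((2 * A)⁻¹ *
        (‖(orderedProd (fun k => hypMatrix (ρ k) (fun i j => η k i j s)) N
            - !![1, 0; 0, 0] : Matrix (Fin 2) (Fin 2) ℂ) 0 j‖ ^ 2
          + ‖(orderedProd (fun k => hypMatrix (ρ k) (fun i j => η k i j s)) N
            - !![1, 0; 0, 0] : Matrix (Fin 2) (Fin 2) ℂ) 1 j‖ ^ 2)) ^ (κ * L)) ∂P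
      ≤ ENNReal.ofReal (((A + 2) * κ
        * Real.exp (800 * C ^ 2 + 100 * A * C + 100 * C / A)) ^ (κ * L)) := by
  have hA0 : 0 < A := by linarith
  have hω0 : 0 < ω := by linarith
  have hL0 : 0 < L := by linarith
  have hN0 : (0 : ℝ) < N := by exact_mod_cast hN
  have hp0 : 0 < κ * L := by positivity
  set d := √(ω / N) with hd
  have hd0 : 0 < d := Real.sqrt_pos.2 (by positivity)
  set E : ℕ → ℝ := fun n => Real.exp (-(d / 2) * ((N : ℝ) - n)) with hE
  set lam : ℕ → ℝ := fun n => potWeight A κ ω (ω + ((N : ℝ) - n)) (E n) with hlam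
  set Γ : ℕ → ℝ := fun n => 800 * C ^ 2 * √(ω / (ω + ((N : ℝ) - n)))
    + 100 * A * C * (ω / (ω + ((N : ℝ) - n))) + 100 * C / A * E n with hΓ
  set e : ℂ := (1 : Matrix (Fin 2) (Fin 2) ℂ) 0 j with he
  have he1 : ‖e‖ ≤ 1 := by
    rw [he, Matrix.one_apply]; split_ifs <;> simp
  set F : ℕ → Matrix (Fin 2) (Fin 2) ℂ → ℝ := fun n M =>
    (‖M 0 j - e‖ ^ 2 + lam n * ‖M 1 j‖ ^ 2 + κ) ^ (κ * L) with hF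
  have mF : ∀ n, Measurable (F n) := by
    intro n
    have h0 := measurable_matrix_apply 0 j
    have h1 := measurable_matrix_apply 1 j
    rw [hF]
    fun_prop
  have hstep : ∀ n < N, ∀ M, ∫⁻ s, ENNReal.ofReal
      (F (n + 1) (hypMatrix (ρ (n + 1)) (fun i j => η (n + 1) i j s) * M)) ∂P
      ≤ ENNReal.ofReal (F n M * Real.exp (κ * L * Γ (n + 1) - κ * L * Γ n)) := by
    intro n hn M
    have hn' : n + 1 ∈ Finset.Icc 1 N := by simp; omega
    have hnN : (n : ℝ) + 1 ≤ N := by exact_mod_cast hn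
    set w : ℝ := ω + ((N : ℝ) - (n + 1 : ℕ)) with hwdef
    have hcast : ((n + 1 : ℕ) : ℝ) = n + 1 := by push_cast; ring
    -- The noise of step `n + 1` lives at scale `w`, while the weight before that step is taken at
    -- `w + 1`.
    have hw1 : w + 1 = ω + ((N : ℝ) - n) := by rw [hwdef, hcast]; ring
    have hww : ω ≤ w := by rw [hwdef, hcast]; linarith
    have hEE : E (n + 1) = E n * Real.exp (d / 2) := by
      rw [hE, ← Real.exp_add]
      show Real.exp _ = Real.exp _
      congr 1
      rw [hcast]; ring
    have hE1 : E n ≤ 1 := by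
      refine Real.exp_le_one_iff.2 ?_
      have : 0 ≤ d * ((N : ℝ) - n) := mul_nonneg hd0.le (by linarith)
      linarith
    have h := lintegral_hypMatrix_step_le hC hR hN hω1 hCω hωN hLω hL2 hA hAC hsmall hκ hκA hp hww
      (by rw [hwdef, hcast]; have : (0 : ℝ) ≤ n := Nat.cast_nonneg n; linarith)
      (Real.exp_pos _ : 0 < E n) hE1 (hρ _ hn') (hη _ hn') e (M 0 j - e) (M 1 j) he1
    have hg := growth_le hA hC hκ hω1 hN0 hLω hp hww (Real.exp_pos _ : 0 < E n)
    rw [← hd, ← hEE, hw1] at hg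
    rw [← hd, ← hEE, hw1] at h
    have eq : ∀ s, F (n + 1) (hypMatrix (ρ (n + 1)) (fun i j => η (n + 1) i j s) * M)
        = (‖M 0 j - e + η (n + 1) 0 1 s * M 1 j‖ ^ 2
          + potWeight A κ ω w (E (n + 1)) * ‖η (n + 1) 1 0 s * (e + (M 0 j - e))
            + (ρ (n + 1) - η (n + 1) 1 1 s) * M 1 j‖ ^ 2 + κ) ^ (κ * L) := by
      intro s
      simp only [hF, hlam, Matrix.mul_apply, Fin.sum_univ_two, hypMatrix]
      simp only [Matrix.of_apply, Matrix.cons_val_zero, Matrix.cons_val_one,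
        Matrix.cons_val', Matrix.cons_val_fin_one, one_mul, add_sub_cancel]
      rw [add_sub_right_comm]
    simp_rw [eq]
    refine h.trans (ENNReal.ofReal_le_ofReal ?_)
    refine mul_le_mul_of_nonneg_left (Real.exp_le_exp.2 ?_) ?_
    · rw [← mul_sub]
      exact mul_le_mul_of_nonneg_left hg hp0.le
    · refine Real.rpow_nonneg ?_ _
      have : 0 < lam n := potWeight_pos hA0 hκ hω0 (by linarith) (Real.exp_pos _)
      positivity
  have main := lintegral_orderedProd_le (Γ := fun n => κ * L * Γ n)
    (fun k hk => measurable_hypMatrix fun i j hij => (hη k hk i j hij).1) hind mF hstep N le_rfl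
  have hΓN : Γ N - Γ 0 ≤ 800 * C ^ 2 + 100 * A * C + 100 * C / A := by
    have h0 : 0 ≤ Γ 0 := by simp only [hΓ, Nat.cast_zero, sub_zero]; positivity
    have hN' : Γ N = 800 * C ^ 2 + 100 * A * C + 100 * C / A := by
      simp [hΓ, hE, div_self hω0.ne']
    linarith
  have hΦ0 : F 0 1 ≤ ((A + 2) * κ) ^ (κ * L) := by
    have hlam0 : lam 0 ≤ (A + 1) * κ := by
      have h1 : ω / (ω + N) ≤ 1 := (div_le_one (by positivity)).2 (by linarith)
      -- `exp (dN/2) ≥ dω/2 = L/2 ≥ 1/(2κ)`: the exponential part of the weight also starts at order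
      -- `κ`.
      have h2 : E 0 ≤ 2 * κ := by
        have h3 : 1 / (2 * κ) ≤ Real.exp (d / 2 * N) := by
          refine le_trans ?_ ((Real.add_one_le_exp _).trans' (by linarith : d / 2 * N ≤ _))
          rw [div_le_iff₀ (by positivity)]
          calc 1 ≤ κ * L := hp
            _ = d * κ * ω := by rw [← hLω]; ring
            _ ≤ d * κ * N := by gcongr
            _ = _ := by ring
        have h4 : E 0 = (Real.exp (d / 2 * N))⁻¹ := by
          rw [← Real.exp_neg]; simp [hE]
        rw [h4, inv_le_comm₀ (Real.exp_pos _) (by positivity)]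
        simpa using h3
      calc lam 0 = A * κ * (ω / (ω + N)) + 1 / (2 * A) * E 0 := by simp [hlam, potWeight]
        _ ≤ A * κ * 1 + 1 / (2 * 1) * (2 * κ) := by gcongr
        _ = _ := by ring
    have hlam0' : 0 ≤ lam 0 :=
      (potWeight_pos hA0 hκ hω0 (by push_cast; linarith) (Real.exp_pos _)).le
    have hle : ‖(1 : Matrix (Fin 2) (Fin 2) ℂ) 1 j‖ ^ 2 ≤ 1 := by
      rw [Matrix.one_apply]; split_ifs <;> simp
    simp only [hF, he, sub_self, norm_zero]
    refine Real.rpow_le_rpow (by positivity) ?_ hp0.le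
    have := mul_le_mul_of_nonneg_left hle hlam0'
    linarith
  refine le_trans (lintegral_mono fun s => ENNReal.ofReal_le_ofReal ?_) (main.trans ?_)
  · simp only [hF]
    have hlamN : (2 * A)⁻¹ ≤ lam N := by
      simp only [hlam, hE, potWeight, sub_self, mul_zero, Real.exp_zero, add_zero,
        div_self hω0.ne', mul_one, one_div]
      have : 0 < A * κ := by positivity
      linarith
    have hA2 : (2 * A)⁻¹ ≤ 1 := inv_le_one_of_one_le₀ (by linarith)
    set M := orderedProd (fun k => hypMatrix (ρ k) (fun i j => η k i j s)) N
    have e0 : (M - !![1, 0; 0, 0] : Matrix (Fin 2) (Fin 2) ℂ) 0 j = M 0 j - e := by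
      rw [Matrix.sub_apply, projection_apply_zero]
    have e1 : (M - !![1, 0; 0, 0] : Matrix (Fin 2) (Fin 2) ℂ) 1 j = M 1 j := by
      rw [Matrix.sub_apply, projection_apply_one, sub_zero]
    rw [e0, e1]
    refine Real.rpow_le_rpow (by positivity) ?_ hp0.le
    have h1 := mul_le_mul_of_nonneg_right hlamN (sq_nonneg ‖M 1 j‖)
    have h2 := mul_le_mul_of_nonneg_right hA2 (sq_nonneg ‖M 0 j - e‖)
    linarith
  · refine ENNReal.ofReal_le_ofReal ?_
    rw [Real.mul_rpow (by positivity) (Real.exp_pos _).le, ← Real.exp_mul, ← mul_sub,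
      mul_comm _ (κ * L)]
    gcongr

/-- The tail bound given by Markov's inequality for the moment of order `κ L`. -/
theorem measureReal_opNorm_ge_le (hC : 0 < C) (hR : 0 < R) (hN : 0 < N) (hω1 : 1 ≤ ω)
    (hCω : C ≤ ω) (hωN : ω ≤ N) (hLω : ω * √(ω / N) = L) (hL2 : 2 ≤ L) (hA : 1 ≤ A)
    (hAC : 80000 * C ≤ A) (hsmall : 20000 * (R * L ^ 3) ≤ ω) (hκ : 0 < κ)
    (hκA : κ ≤ 1 / (2 * A ^ 2)) (hp : 1 ≤ κ * L)
    (hρ : ∀ k ∈ Finset.Icc 1 N, ‖ρ k‖ ≤ Real.exp (-√((ω + ((N : ℝ) - k)) / N)))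
    (hη : ∀ k ∈ Finset.Icc 1 N, ∀ i j : Fin 2, (i, j) ≠ (0, 0) → Measurable (η k i j) ∧
      ‖∫ s, η k i j s ∂P‖ ≤ C / (ω + ((N : ℝ) - k)) ∧
      complexVar P (η k i j) ≤ C / (ω + ((N : ℝ) - k)) ∧
      ∀ᵐ s ∂P, ‖η k i j s‖ ≤ √(R * L / (ω + ((N : ℝ) - k))))
    (hind : iIndepFun (fun (k : Finset.Icc 1 N) (s : S) =>
      hypMatrix (ρ k) (fun i j => η k i j s)) P) {ε : ℝ} (hε : 0 < ε) :
    P.real {s | ε ≤ opNorm (orderedProd (fun k => hypMatrix (ρ k) (fun i j => η k i j s)) N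
        - !![1, 0; 0, 0])}
      ≤ 2 * (4 * A * (A + 2) * Real.exp (800 * C ^ 2 + 100 * A * C + 100 * C / A)
          * (κ / ε ^ 2)) ^ (κ * L) := by
  have hA0 : 0 < A := by linarith
  have hp0 : 0 < κ * L := by linarith
  set M : S → Matrix (Fin 2) (Fin 2) ℂ := fun s =>
    orderedProd (fun k => hypMatrix (ρ k) (fun i j => η k i j s)) N - !![1, 0; 0, 0] with hM
  set G := Real.exp (800 * C ^ 2 + 100 * A * C + 100 * C / A) with hG
  have hG0 : 0 < G := Real.exp_pos _
  set V : Fin 2 → S → ℝ := fun j s =>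
    ((2 * A)⁻¹ * (‖M s 0 j‖ ^ 2 + ‖M s 1 j‖ ^ 2)) ^ (κ * L) with hV
  have mX : Measurable fun s => orderedProd (fun k => hypMatrix (ρ k) (fun i j => η k i j s)) N :=
    measurable_orderedProd fun k hk => measurable_hypMatrix fun i j hij => (hη k hk i j hij).1
  have mV : ∀ j, Measurable (V j) := by
    intro j
    have h0 := measurable_matrix_iff.1 mX 0 j
    have h1 := measurable_matrix_iff.1 mX 1 j
    simp only [hV, hM, Matrix.sub_apply]
    fun_prop
  -- Each column receives half of `ε²`: if both stay below that level, the Frobenius norm, hence the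
  -- operator norm, is below `ε`.
  set a := ((2 * A)⁻¹ * (ε ^ 2 / 2)) ^ (κ * L) with ha
  have ha0 : 0 < a := by positivity
  set q := (4 * A * (A + 2) * G * (κ / ε ^ 2)) ^ (κ * L) with hq
  have hq0 : 0 ≤ q := by positivity
  have tail : ∀ j, P.real {s | a ≤ V j s} ≤ q := by
    intro j
    have h := lintegral_column_le hC hR hN hω1 hCω hωN hLω hL2 hA hAC hsmall hκ hκA hp hρ hη hind j
    have h2 : P {s | a ≤ V j s} ≤ ENNReal.ofReal q := by
      calc P {s | a ≤ V j s} ≤ P {s | ENNReal.ofReal a ≤ ENNReal.ofReal (V j s)} :=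
            measure_mono fun s hs => ENNReal.ofReal_le_ofReal hs
        _ ≤ (∫⁻ s, ENNReal.ofReal (V j s) ∂P) / ENNReal.ofReal a :=
            meas_ge_le_lintegral_div (mV j).ennreal_ofReal.aemeasurable
              (by simpa using ha0) ENNReal.ofReal_ne_top
        _ ≤ ENNReal.ofReal (((A + 2) * κ * G) ^ (κ * L)) / ENNReal.ofReal a := by
            gcongr
        _ = ENNReal.ofReal q := by
            rw [← ENNReal.ofReal_div_of_pos ha0, ha, ← Real.div_rpow (by positivity) (by positivity),
              hq]
            congr 2
            field_simp
            norm_num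
    exact ENNReal.toReal_le_of_le_ofReal hq0 h2
  have hsub : {s | ε ≤ opNorm (M s)} ⊆ {s | a ≤ V 0 s} ∪ {s | a ≤ V 1 s} := by
    intro s hs
    by_contra hcon
    simp only [Set.mem_union, Set.mem_ofPred_eq, not_or, not_le] at hcon hs
    have hlt : ∀ j, V j s < a → ‖M s 0 j‖ ^ 2 + ‖M s 1 j‖ ^ 2 < ε ^ 2 / 2 := by
      intro j hj
      have := (Real.rpow_lt_rpow_iff (by positivity) (by positivity) hp0).1 hj
      exact lt_of_mul_lt_mul_left this (by positivity)
    have h0 := hlt 0 hcon.1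
    have h1 := hlt 1 hcon.2
    have h2 := opNorm_sq_le (M s)
    have h3 : ε ^ 2 ≤ opNorm (M s) ^ 2 := by gcongr
    linarith
  calc P.real {s | ε ≤ opNorm (M s)} ≤ P.real ({s | a ≤ V 0 s} ∪ {s | a ≤ V 1 s}) :=
        measureReal_mono hsub
    _ ≤ P.real {s | a ≤ V 0 s} + P.real {s | a ≤ V 1 s} := measureReal_union_le _ _
    _ ≤ 2 * q := by linarith [tail 0, tail 1]

end Moment

/-! ### Asymptotic regime and choice of the parameters -/

theorem omegaN_mul_sqrt {N : ℕ} {Ω : ℝ} (hN : 0 < N) (hL : 0 ≤ Ω * Real.log N) :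
    omegaN N Ω * √(omegaN N Ω / N) = Ω * Real.log N := by
  have hN0 : (0 : ℝ) < N := by exact_mod_cast hN
  unfold omegaN
  set L := Ω * Real.log N
  set a := (N : ℝ) ^ (1 / 3 : ℝ) with ha
  set b := L ^ (1 / 3 : ℝ) with hb
  have ha0 : 0 < a := by positivity
  have hb0 : 0 ≤ b := by positivity
  have ha3 : a ^ 3 = N := by
    rw [ha, ← Real.rpow_natCast, ← Real.rpow_mul hN0.le]; norm_num
  have hb3 : b ^ 3 = L := by
    rw [hb, ← Real.rpow_natCast, ← Real.rpow_mul hL]; norm_num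
  have hb2 : L ^ (2 / 3 : ℝ) = b ^ 2 := by
    rw [hb, ← Real.rpow_natCast, ← Real.rpow_mul hL]; norm_num
  have h1 : a * b ^ 2 / a ^ 3 = (b / a) ^ 2 := by field_simp
  rw [hb2, ← hb3, ← ha3, h1, Real.sqrt_sq (by positivity)]
  field_simp

/-- Eventually the sequence `Ω` lies in the regime in which the moment bound applies, unless
`R * Ω N ≤ 4`. -/
theorem eventually_regime {R C K : ℝ} (hR : 0 < R) {Ω : ℕ → ℝ} (hΩ : ∀ N, 0 < Ω N)
    (ho : Ω =o[atTop] fun N : ℕ => (N : ℝ) ^ (1 / 10 : ℝ) / Real.log N) :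
    ∀ᶠ N : ℕ in atTop, 0 < N ∧ (4 < R * Ω N →
      1 ≤ omegaN N (Ω N) ∧ C ≤ omegaN N (Ω N) ∧ omegaN N (Ω N) ≤ N ∧
      2 ≤ Ω N * Real.log N ∧ K ≤ Ω N * Real.log N ∧
      20000 * (R * (Ω N * Real.log N) ^ 3) ≤ omegaN N (Ω N)) := by
  have tl : Tendsto (fun N : ℕ => Real.log N) atTop atTop :=
    Real.tendsto_log_atTop.comp tendsto_natCast_atTop_atTop
  have tp : ∀ a : ℝ, 0 < a → Tendsto (fun N : ℕ => (N : ℝ) ^ a) atTop atTop := fun a ha =>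
    (tendsto_rpow_atTop ha).comp tendsto_natCast_atTop_atTop
  -- `L ≤ N^(1/10)` and `ω ≥ N^(1/3)` leave a margin `N^(1/30)` in `R L³ ≲ ω`, since `1/3 - 3/10 =
  -- 1/30`. The threshold on `log N` turns `R Ω > 4` into `L ≥ max 2 K`.
  filter_upwards [eventually_gt_atTop 0, ho.def one_pos, tl.eventually_ge_atTop 1,
    tl.eventually_ge_atTop (max 2 K * R / 4), (tp (1 / 3) (by norm_num)).eventually_ge_atTop (max 1 C),
    (tp (1 / 30) (by norm_num)).eventually_ge_atTop (20000 * R)] with N hN h1 h2 h3 h4 h5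
  refine ⟨hN, fun hRΩ => ?_⟩
  have hN1 : (1 : ℝ) ≤ N := by exact_mod_cast hN
  have hN0 : (0 : ℝ) < N := by linarith
  have hlog : 0 < Real.log N := by linarith
  set L := Ω N * Real.log N with hL
  have hLN : L ≤ (N : ℝ) ^ (1 / 10 : ℝ) := by
    rw [one_mul, Real.norm_of_nonneg (hΩ N).le, Real.norm_of_nonneg (by positivity),
      le_div_iff₀ hlog] at h1
    exact h1
  have hLK : max 2 K ≤ L := by
    have h6 : R * L = R * Ω N * Real.log N := by rw [hL]; ring
    have h7 : 4 * Real.log N ≤ R * Ω N * Real.log N := by gcongr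
    refine le_of_mul_le_mul_left ?_ hR
    linarith
  have hL2 : 2 ≤ L := (le_max_left _ _).trans hLK
  have hωN : (N : ℝ) ^ (1 / 3 : ℝ) ≤ omegaN N (Ω N) := by
    unfold omegaN
    exact le_mul_of_one_le_right (by positivity) (Real.one_le_rpow (by linarith) (by norm_num))
  refine ⟨(le_max_left _ _).trans (h4.trans hωN), (le_max_right _ _).trans (h4.trans hωN), ?_, hL2,
    (le_max_right _ _).trans hLK, ?_⟩
  · unfold omegaN
    calc (N : ℝ) ^ (1 / 3 : ℝ) * L ^ (2 / 3 : ℝ)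
        ≤ (N : ℝ) ^ (1 / 3 : ℝ) * ((N : ℝ) ^ (1 : ℝ)) ^ (2 / 3 : ℝ) := by
          gcongr
          exact hLN.trans (Real.rpow_le_rpow_of_exponent_le hN1 (by norm_num))
      _ = N := by
          rw [← Real.rpow_mul hN0.le, ← Real.rpow_add hN0]; norm_num
  · calc 20000 * (R * L ^ 3) = 20000 * R * L ^ 3 := by ring
      _ ≤ (N : ℝ) ^ (1 / 30 : ℝ) * ((N : ℝ) ^ (1 / 10 : ℝ)) ^ 3 := by gcongr
      _ = (N : ℝ) ^ (1 / 3 : ℝ) := by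
          rw [← Real.rpow_natCast, ← Real.rpow_mul hN0.le, ← Real.rpow_add hN0]; norm_num
      _ ≤ _ := hωN

theorem natCast_rpow_eq_exp {N : ℕ} (hN : 0 < N) (x : ℝ) :
    (N : ℝ) ^ x = Real.exp (x * Real.log N) := by
  rw [Real.rpow_def_of_pos (by exact_mod_cast hN), mul_comm]

theorem theorem3p3 (R C : ℝ) (hR : 0 < R) (hC : 0 < C) :
    ∃ c : ℝ, 0 < c ∧
      ∀ Ω : ℕ → ℝ, (∀ N, 0 < Ω N) →
        (Ω =o[atTop] fun N : ℕ => (N : ℝ) ^ (1 / 10 : ℝ) / Real.log N) →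
        ∃ N₀ : ℕ, ∀ N : ℕ, N₀ ≤ N →
          ∀ (S : Type*) [MeasurableSpace S] (P : Measure S) [IsProbabilityMeasure P]
            (c₀ : ℝ) (ρ : ℕ → ℂ) (η : ℕ → Fin 2 → Fin 2 → S → ℂ),
            1 < c₀ →
            (∀ k ∈ Finset.Icc 1 N,
              ‖ρ k‖ ≤ Real.exp (-c₀ * Real.sqrt (omegaHat N (Ω N) k / N))) →
            (∀ k ∈ Finset.Icc 1 N, ∀ i j : Fin 2, (i, j) ≠ (0, 0) →
              Measurable (η k i j) ∧
              ‖∫ s, η k i j s ∂P‖ ≤ C / omegaHat N (Ω N) k ∧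
              complexVar P (η k i j) ≤ C / omegaHat N (Ω N) k ∧
              ∀ᵐ s ∂P, ‖η k i j s‖ ≤
                Real.sqrt (R * Ω N * Real.log N / omegaHat N (Ω N) k)) →
            iIndepFun (fun (k : Finset.Icc 1 N) (s : S) =>
              hypMatrix (ρ k) (fun i j => η k i j s)) P →
            ∀ ε : ℝ, (N : ℝ) ^ (-R) ≤ ε →
              P.real {s | ε ≤ opNorm
                  (orderedProd (fun k => hypMatrix (ρ k) (fun i j => η k i j s)) N
                    - !![1, 0; 0, 0])} ≤
                c⁻¹ * ((N : ℝ) ^ (-(c * ε ^ 2 * Ω N)) + (N : ℝ) ^ (4 - R * Ω N)) := by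
  set A : ℝ := 1 + 80000 * C with hAdef
  have hA : 1 ≤ A := by linarith
  have hA0 : 0 < A := by linarith
  -- The largest `κ` for which the moment bound is available.
  set t : ℝ := 1 / (2 * A ^ 2) with ht
  have ht0 : 0 < t := by positivity
  set K : ℝ := 4 * A * (A + 2) * Real.exp (800 * C ^ 2 + 100 * A * C + 100 * C / A) with hK
  have hK2 : 2 ≤ K := by
    have h1 : 1 ≤ Real.exp (800 * C ^ 2 + 100 * A * C + 100 * C / A) :=
      Real.one_le_exp (by positivity)
    calc (2 : ℝ) ≤ 4 * 1 * (0 + 2) * 1 := by norm_num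
      _ ≤ K := by rw [hK]; gcongr
  have hK0 : 0 < K := by linarith
  -- In `K c = exp (-(1 + R/t))` the summand 1 yields `exp (-c ε² L)` when `κ = c ε²`, and `R/t`
  -- yields `exp (-R L)` when `κ = t`.
  set c : ℝ := Real.exp (-(1 + R / t)) / K with hc
  have hc0 : 0 < c := by positivity
  have hKc : K * c = Real.exp (-(1 + R / t)) := by rw [hc]; field_simp
  have hcinv : c⁻¹ = K * Real.exp (1 + R / t) := by
    rw [hc, inv_div, Real.exp_neg, div_inv_eq_mul]
  have hcinve : Real.exp 1 ≤ c⁻¹ := by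
    rw [hcinv]
    have h1 : Real.exp 1 ≤ Real.exp (1 + R / t) :=
      Real.exp_le_exp.2 (by linarith [(by positivity : 0 < R / t)])
    exact h1.trans (le_mul_of_one_le_left (Real.exp_pos _).le (by linarith))
  have hcinv2 : 2 ≤ c⁻¹ := by linarith [Real.exp_one_gt_d9]
  refine ⟨c, hc0, fun Ω hΩ ho => ?_⟩
  obtain ⟨N₀, hN₀⟩ := eventually_atTop.1 (eventually_regime (C := C) (K := 1 / t) hR hΩ ho)
  refine ⟨N₀, fun N hNN S _ P _ c₀ ρ η hc₀ hρ hη hind ε hε => ?_⟩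
  obtain ⟨hN, hreg⟩ := hN₀ N hNN
  have hN1 : (1 : ℝ) ≤ N := by exact_mod_cast hN
  have hN0 : (0 : ℝ) < N := by linarith
  have hε0 : 0 < ε := (Real.rpow_pos_of_pos hN0 _).trans_le hε
  have hle1 : P.real {s | ε ≤ opNorm
      (orderedProd (fun k => hypMatrix (ρ k) (fun i j => η k i j s)) N - !![1, 0; 0, 0])} ≤ 1 :=
    measureReal_le_one
  -- For `R Ω ≤ 4` the second term on the right is at least 1 and the claim is trivial.
  rcases le_or_gt (R * Ω N) 4 with hRΩ | hRΩ
  · have h1 : 1 ≤ (N : ℝ) ^ (4 - R * Ω N) := Real.one_le_rpow hN1 (by linarith)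
    have h2 : 0 ≤ (N : ℝ) ^ (-(c * ε ^ 2 * Ω N)) := by positivity
    nlinarith
  obtain ⟨hω1, hCω, hωN, hL2, hKL, hsmall⟩ := hreg hRΩ
  set L := Ω N * Real.log N with hL
  have hL0 : 0 < L := by linarith
  have e1 : (N : ℝ) ^ (-(c * ε ^ 2 * Ω N)) = Real.exp (-(c * ε ^ 2 * L)) := by
    rw [natCast_rpow_eq_exp hN]; congr 1; rw [hL]; ring
  have e2 : Real.exp (-(R * L)) ≤ (N : ℝ) ^ (4 - R * Ω N) := by
    rw [natCast_rpow_eq_exp hN]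
    refine Real.exp_le_exp.2 ?_
    have := Real.log_nonneg hN1
    rw [hL]; linarith
  have e3 : 0 ≤ (N : ℝ) ^ (4 - R * Ω N) := by positivity
  rw [e1]
  -- Below 1, the choice `κ = c ε²` would violate `κ L ≥ 1`, but then the first term is at least
  -- `exp (-1)` and `c⁻¹ ≥ e` makes the bound trivial.
  rcases lt_or_ge (c * ε ^ 2 * L) 1 with hsm | hsm
  · have h1 : Real.exp (-1) ≤ Real.exp (-(c * ε ^ 2 * L)) := Real.exp_le_exp.2 (by linarith)
    refine hle1.trans ?_
    calc (1 : ℝ) = Real.exp 1 * (Real.exp (-1) + 0) := by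
          rw [add_zero, ← Real.exp_add]; simp
      _ ≤ _ := by gcongr
  have hLω := omegaN_mul_sqrt hN hL0.le
  have hρ' : ∀ k ∈ Finset.Icc 1 N,
      ‖ρ k‖ ≤ Real.exp (-√((omegaN N (Ω N) + ((N : ℝ) - k)) / N)) := by
    intro k hk
    refine (hρ k hk).trans (Real.exp_le_exp.2 ?_)
    rw [neg_mul, neg_le_neg_iff]
    exact le_mul_of_one_le_left (Real.sqrt_nonneg _) hc₀.le
  have tail : ∀ κ : ℝ, 0 < κ → κ ≤ t → 1 ≤ κ * L → _ := fun κ hκ hκt hp =>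
    measureReal_opNorm_ge_le (A := A) (κ := κ) hC hR hN hω1 hCω hωN hLω hL2 hA (by linarith)
      hsmall hκ hκt hp hρ' (by simpa only [omegaHat, mul_assoc, hL] using hη) hind hε0
  rw [← hK] at tail
  -- The choice `κ = c ε²` gives the first term; when it is inadmissible, `κ = t` gives the second.
  rcases le_or_gt (c * ε ^ 2) t with hct | hct
  · have h := tail (c * ε ^ 2) (by positivity) hct hsm
    have h1 : K * (c * ε ^ 2 / ε ^ 2) = Real.exp (-(1 + R / t)) := by
      rw [← hKc]; field_simp
    rw [h1, ← Real.exp_mul] at h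
    refine h.trans ?_
    have h2 : Real.exp (-(1 + R / t) * (c * ε ^ 2 * L)) ≤ Real.exp (-(c * ε ^ 2 * L)) := by
      refine Real.exp_le_exp.2 ?_
      have : 0 ≤ R / t * (c * ε ^ 2 * L) := by positivity
      linarith
    calc 2 * Real.exp (-(1 + R / t) * (c * ε ^ 2 * L))
        ≤ c⁻¹ * (Real.exp (-(c * ε ^ 2 * L)) + 0) := by rw [add_zero]; gcongr
      _ ≤ _ := by gcongr
  · have htL : 1 ≤ t * L := by
      rw [div_le_iff₀ ht0] at hKL; linarith
    have h := tail t ht0 le_rfl htL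
    have h1 : K * (t / ε ^ 2) ≤ Real.exp (-(1 + R / t)) := by
      rw [← hKc]
      gcongr
      rw [div_le_iff₀ (by positivity)]
      exact hct.le
    have h2 : (K * (t / ε ^ 2)) ^ (t * L) ≤ Real.exp (-(R * L)) := by
      calc (K * (t / ε ^ 2)) ^ (t * L) ≤ Real.exp (-(1 + R / t)) ^ (t * L) := by gcongr
        _ = Real.exp (-(t * L) - R * L) := by
            rw [← Real.exp_mul]; congr 1; field_simp; ring
        _ ≤ _ := Real.exp_le_exp.2 (by linarith)
    calc _ ≤ 2 * (K * (t / ε ^ 2)) ^ (t * L) := h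
      _ ≤ c⁻¹ * (0 + (N : ℝ) ^ (4 - R * Ω N)) := by
          rw [zero_add]
          exact mul_le_mul hcinv2 (h2.trans e2) (by positivity) (by positivity)
      _ ≤ _ := by gcongr; positivity
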